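/- For $p,q\in\mathbb{C}$ with $|p|,|q|<1$ put $(z;q)_\infty=\prod_{j\ge 0}(1-zq^j)$, $(z;p,q)_\infty=\prod_{j,k\ge 0}(1-zp^jq^k)$ and let $$\Gamma(z;p,q)=\frac{(pqz^{-1};p,q)_\infty}{(z;p,q)_\infty}\qquad(z\in\mathbb{C}\setminus\{0\})$$ be the elliptic gamma function; write $\Gamma(tz^{\pm1};p,q)=\Gamma(tz;p,q)\,\Gamma(tz^{-1};p,q)$ and $\Gamma(z^{\pm2};p,q)=\Gamma(z^2;p,q)\,\Gamma(z^{-2};p,q)$. **Theorem (elliptic beta integral).** Let $t_1,\dots,t_6,p,q\in\mathbb{C}$ satisfy $0<|p|,|q|<1$, $|t_j|<1$ for $j=1,\dots,6$, and $\prod_{j=1}^6t_j=pq$. Then the integral below converges and $$\frac{(p;p)_\infty(q;q)_\infty}{4\pi \mathrm{i}}\int_{\mathbb{T}}\frac{\prod_{j=1}^6\Gamma(t_jz^{\pm1};p,q)}{\Gamma(z^{\pm2};p,q)}\,\frac{dz}{z}=\prod_{1\le j<k\le 6}\Gamma(t_jt_k;p,q),$$ where $\mathbb{T}$ is the positively oriented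 unit circle. (At the poles $z=\pm1$ of $\Gamma(z^{\pm2};p,q)$ the integrand is understood to be $0$, its continuous extension.) -/

import Mathlib

/-- The infinite `q`-shifted factorial `(z; q)_∞ = ∏_{j ≥ 0} (1 - z q^j)`, for `|q| < 1`. -/
noncomputable def qShifted (z q : ℂ) : ℂ :=
  ∏' j : ℕ, (1 - z * q ^ j)

/-- The double infinite product `(z; p, q)_∞ = ∏_{j, k ≥ 0} (1 - z p^j q^k)`,
for `|p|, |q| < 1`. -/
noncomputable def pqShifted (z p q : ℂ) : ℂ :=
  ∏' jk : ℕ × ℕ, (1 - z * p ^ jk.1 * q ^ jk.2)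

/-- The product defining `(z; q)_∞` converges for `|q| < 1`. -/
theorem multipliable_qShifted (z : ℂ) {q : ℂ} (hq : ‖q‖ < 1) :
    Multipliable fun j : ℕ => 1 - z * q ^ j := by
  have hs : Summable fun j : ℕ => -(z * q ^ j) :=
    ((summable_geometric_of_norm_lt_one hq).mul_left z).neg
  simpa [sub_eq_add_neg] using Complex.multipliable_one_add_of_summable hs

/-- The product defining `(z; p, q)_∞` converges for `|p|, |q| < 1`. -/
theorem multipliable_pqShifted (z : ℂ) {p q : ℂ} (hp : ‖p‖ < 1) (hq : ‖q‖ < 1) :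
    Multipliable fun jk : ℕ × ℕ => 1 - z * p ^ jk.1 * q ^ jk.2 := by
  have h : Summable fun jk : ℕ × ℕ => p ^ jk.1 * q ^ jk.2 :=
    summable_mul_of_summable_norm (summable_norm_geometric_of_norm_lt_one hp)
      (summable_norm_geometric_of_norm_lt_one hq)
  have hs : Summable fun jk : ℕ × ℕ => -(z * p ^ jk.1 * q ^ jk.2) := by
    simpa [mul_assoc] using (h.mul_left z).neg
  simpa [sub_eq_add_neg] using Complex.multipliable_one_add_of_summable hs

/-- The (standard) elliptic gamma function
`Γ(z; p, q) = (p q z⁻¹; p, q)_∞ / (z; p, q)_∞`, for `z ≠ 0` and `|p|, |q| < 1`.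
At a pole, Lean's division gives it the value `0`, so that its reciprocal there
has the correct value `0`. -/
noncomputable def ellipticGamma (z p q : ℂ) : ℂ :=
  pqShifted (p * q * z⁻¹) p q / pqShifted z p q

/-- The integrand
`∏_{j=1}^{6} Γ(t_j z^{±1}; p, q) / Γ(z^{±2}; p, q) · 1/z` of the elliptic beta integral, where
`Γ(t z^{±1}; p, q) = Γ(t z; p, q) Γ(t z⁻¹; p, q)` and
`Γ(z^{±2}; p, q) = Γ(z²; p, q) Γ(z⁻²; p, q)`. -/
noncomputable def ellipticBetaIntegrand (t : Fin 6 → ℂ) (p q z : ℂ) : ℂ :=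
  (∏ j, ellipticGamma (t j * z) p q * ellipticGamma (t j * z⁻¹) p q) /
    (ellipticGamma (z ^ 2) p q * ellipticGamma (z⁻¹ ^ 2) p q) / z

/-!
The quotient of the integral, normalized as the average of `z * ellipticBetaIntegrand t p q z`
over the unit circle, by the product `∏_{j < k} Γ(t_j t_k; p, q)` is shown to be independent of
the parameters `t`, and is then evaluated by a limit to the boundary of the parameter domain.

*Contiguous relation.* An identity for theta functions in six parameters (`theta_six_term`,
deduced from Weierstrass' addition formula `theta_four_term`) shows that a combination of the
integrands for `(s, q a, b, c, d, e)` and `(q s, a, b, c, d, e)` has the form `h(q z) - h(z)` with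
`h` holomorphic on the annulus `|q| ≤ |z| ≤ 1`. Such a difference has mean zero on the unit
circle, which gives `circleAverage_betaKernel_contiguous`. The product side satisfies the same
relation, so the quotient `betaRatio` does not notice which of the two parameters carries the
factor `q` (`betaRatio_contiguous`).

*Constancy.* With four parameters and the product `B` of the other two fixed, the quotient is thus
a holomorphic function of one parameter `x` on the annulus `|B| < |x| < 1`, invariant under `x ↦ q
x`. If the annulus is wide enough to contain `x` and `q x`, the Laurent expansion shows that it is
constant (`eq_of_mul_invariant_on_annulus`). Exchanging pairs in this way connects all parameters
with `|t_2|, …, |t_6| > |p| ^ (1 / 5)` (`betaRatio_eq_of_lt_norm`), and the identity theorem in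
logarithmic coordinates, where the admissible parameters form a convex set, extends constancy to
all of them (`betaRatio_eq`).

*Evaluation.* At `t = (i √s, -i √s, κ s^{-1/4}, …, κ s^{-1/4})` with `κ⁴ = p q`, the factors that
degenerate as `s → 1` make up the Poisson kernel `(1 - s²) / |1 + s z²|²`
(`betaRatio_limitParams`). It concentrates at `z = ±i`, where the remaining continuous density has
the value `2 / ((p; p)_∞ (q; q)_∞)` (`tendsto_circleAverage_poisson_sq`, `limitDensity_one`).
-/

/-! ### Circle averages and Laurent coefficients -/

open Real in
theorem circleAverage_comp_const_mul (f : ℂ → ℂ) (a : ℂ) (R : ℝ) :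
    circleAverage (fun z => f (a * z)) 0 R = circleAverage f 0 (‖a‖ * R) := by
  rw [circleAverage_eq_integral_add (f := f) a.arg, circleAverage]
  congr 1
  refine intervalIntegral.integral_congr fun θ _ => ?_
  have h : a * circleMap 0 R θ = circleMap 0 (‖a‖ * R) (θ + a.arg) := by
    conv_lhs => rw [← Complex.norm_mul_exp_arg_mul_I a]
    simp only [circleMap, zero_add]
    push_cast
    rw [add_mul, Complex.exp_add]
    ring
  simp only [h]

open Real Metric in
/-- Averages over the two boundary circles of an annulus agree for a function holomorphic in
between, by Cauchy's theorem applied to `f z / z`. -/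
theorem circleAverage_eq_of_annulus {f : ℂ → ℂ} {r R : ℝ} (hr : 0 < r) (hrR : r ≤ R)
    (hc : ContinuousOn f {z | r ≤ ‖z‖ ∧ ‖z‖ ≤ R})
    (hd : ∀ z, r < ‖z‖ → ‖z‖ < R → DifferentiableAt ℂ f z) :
    circleAverage f 0 R = circleAverage f 0 r := by
  rw [circleAverage_eq_circleIntegral (hr.trans_le hrR).ne', circleAverage_eq_circleIntegral hr.ne',
    Complex.circleIntegral_sub_center_inv_smul_eq_of_differentiable_on_annulus_off_countable hr hrR
      Set.countable_empty]
  · refine hc.mono fun z hz => ?_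
    simpa [and_comm] using hz
  · intro z hz
    simp only [Set.sdiff_empty, Set.mem_sdiff, mem_ball, mem_closedBall, dist_zero_right,
      not_le] at hz
    exact hd z hz.2 hz.1

open Real in
/-- A continuous function on a circle whose Fourier coefficients all vanish is zero. -/
theorem eq_zero_of_circleAverage_zpow_mul {f : ℂ → ℂ} {R : ℝ} (hR : 0 < R)
    (hc : ContinuousOn f (Metric.sphere 0 R))
    (h : ∀ n : ℤ, circleAverage (fun z => z ^ n * f z) 0 R = 0) {z : ℂ} (hz : ‖z‖ = R) :
    f z = 0 := by
  have : Fact (0 < 2 * π) := ⟨two_pi_pos⟩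
  have hper : Function.Periodic (fun θ : ℝ => f (circleMap 0 R θ)) (2 * π) := fun θ => by
    simp [periodic_circleMap 0 R θ]
  have hcont : Continuous (fun θ : ℝ => f (circleMap 0 R θ)) :=
    hc.comp_continuous (continuous_circleMap 0 R) fun θ => circleMap_mem_sphere 0 hR.le θ
  let F : C(AddCircle (2 * π), ℂ) :=
    ⟨hper.lift, continuous_coinduced_dom.mpr hcont⟩
  have hF : ∀ θ : ℝ, F (θ : AddCircle (2 * π)) = f (circleMap 0 R θ) := fun θ => hper.lift_coe θ
  have hcoef : fourierCoeff F = 0 := by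
    funext n
    rw [fourierCoeff_eq_intervalIntegral F n 0, zero_add]
    have h1 := h (-n)
    rw [circleAverage] at h1
    have h2 : (∫ θ in 0..2 * π, circleMap 0 R θ ^ (-n) * f (circleMap 0 R θ)) = 0 := by
      rcases smul_eq_zero.mp h1 with h1 | h1
      · exact absurd h1 (inv_ne_zero two_pi_pos.ne')
      · exact h1
    have h3 : (fun x : ℝ => @fourier (2 * π) (-n) x • F x) =
        fun θ : ℝ => (R : ℂ) ^ n * (circleMap 0 R θ ^ (-n) * f (circleMap 0 R θ)) := by
      funext θ
      rw [hF, fourier_coe_apply, smul_eq_mul, ← mul_assoc]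
      congr 1
      have hπ : (π : ℂ) ≠ 0 := by exact_mod_cast pi_ne_zero
      rw [circleMap, zero_add, mul_zpow, ← Complex.exp_int_mul, zpow_neg, ← mul_assoc,
        mul_inv_cancel₀ (zpow_ne_zero _ (by exact_mod_cast hR.ne')), one_mul]
      congr 1
      push_cast
      field_simp
    rw [h3, intervalIntegral.integral_const_mul, h2]
    simp
  have hsum := hasSum_fourier_series_of_summable (f := F) (by rw [hcoef]; exact summable_zero)
  have hF0 : F = 0 := by
    rw [hcoef] at hsum
    simpa using hsum.unique (by simp)
  have hz' : z = circleMap 0 R z.arg := by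
    rw [circleMap, zero_add, ← hz, Complex.norm_mul_exp_arg_mul_I]
  rw [hz', ← hF, hF0]
  rfl

open Real in
theorem circleAverage_zpow_mul_eq {f : ℂ → ℂ} {ρ R : ℝ}
    (hf : DifferentiableOn ℂ f {z | ρ < ‖z‖ ∧ ‖z‖ < R}) (hρ : 0 ≤ ρ) (n : ℤ) {r s : ℝ}
    (hr : ρ < r) (hr' : r < R) (hs : ρ < s) (hs' : s < R) :
    circleAverage (fun z => z ^ n * f z) 0 r = circleAverage (fun z => z ^ n * f z) 0 s := by
  wlog hrs : r ≤ s generalizing r s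
  · exact (this hs hs' hr hr' (le_of_not_ge hrs)).symm
  have hopen : IsOpen {z : ℂ | ρ < ‖z‖ ∧ ‖z‖ < R} :=
    (isOpen_lt continuous_const continuous_norm).inter (isOpen_lt continuous_norm continuous_const)
  have hd : ∀ z : ℂ, ρ < ‖z‖ → ‖z‖ < R → DifferentiableAt ℂ (fun z => z ^ n * f z) z :=
    fun z h1 h2 => (differentiableAt_zpow.mpr (Or.inl (norm_pos_iff.mp (hρ.trans_lt h1)))).mul
      (hf.differentiableAt (hopen.mem_nhds ⟨h1, h2⟩))
  refine (circleAverage_eq_of_annulus (hρ.trans_lt hr) hrs (fun z hz => ?_) fun z h1 h2 =>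
    hd z (hr.trans h1) (h2.trans hs')).symm
  exact (hd z (hr.trans_le hz.1) (hz.2.trans_lt hs')).continuousAt.continuousWithinAt

open Real in
/-- A holomorphic function on the annulus `ρ < |z| < R` that is invariant under `z ↦ q z`, whenever
both points lie in the annulus, is constant on the set of points that can be shifted: invariance
multiplies the Laurent coefficient of index `-n` by `q ^ n`, which leaves only the constant term. -/
theorem eq_of_mul_invariant_on_annulus {f : ℂ → ℂ} {ρ R : ℝ} {q : ℂ} (hq : ‖q‖ < 1)
    (hρ : 0 ≤ ρ) (hf : DifferentiableOn ℂ f {z | ρ < ‖z‖ ∧ ‖z‖ < R})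
    (hinv : ∀ z, ρ < ‖q * z‖ → ‖z‖ < R → f (q * z) = f z) {x y : ℂ}
    (hx : ρ < ‖q * x‖) (hx' : ‖x‖ < R) (hy : ρ < ‖q * y‖) (hy' : ‖y‖ < R) : f x = f y := by
  have hlt : ∀ {z : ℂ}, ρ < ‖q * z‖ → ρ < ‖z‖ := fun {z} hz => by
    rw [norm_mul] at hz
    nlinarith [norm_nonneg z]
  -- the coefficients on the circles of radius `‖z‖` and `‖q * z‖` agree, and differ by `q ^ n`
  have hcoef : ∀ z : ℂ, ρ < ‖q * z‖ → ‖z‖ < R → ∀ n : ℤ, n ≠ 0 →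
      circleAverage (fun w => w ^ n * f w) 0 ‖z‖ = 0 := by
    intro z hz hz' n hn
    have h1 : circleAverage (fun w => (q * w) ^ n * f (q * w)) 0 ‖z‖ =
        q ^ n * circleAverage (fun w => w ^ n * f w) 0 ‖z‖ := by
      rw [← smul_eq_mul, ← circleAverage_fun_smul]
      refine circleAverage_congr_sphere fun w hw => ?_
      have hw' : ‖w‖ = ‖z‖ := by simpa using hw
      simp only [smul_eq_mul]
      rw [hinv w (by rwa [norm_mul, hw', ← norm_mul]) (hw' ▸ hz'), mul_zpow]
      ring
    rw [circleAverage_comp_const_mul (fun w => w ^ n * f w), ← norm_mul,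
      circleAverage_zpow_mul_eq hf hρ n hz ?_ (hlt hz) hz'] at h1
    · have h2 : (1 - q ^ n) * circleAverage (fun w => w ^ n * f w) 0 ‖z‖ = 0 := by
        linear_combination h1
      rcases mul_eq_zero.mp h2 with h3 | h3
      · exfalso
        have h4 : ‖q‖ ^ n = 1 := by rw [← norm_zpow, ← sub_eq_zero.mp h3, norm_one]
        exact hn ((zpow_eq_one_iff_right₀ (norm_nonneg q) hq.ne).mp h4)
      · exact h3
    · rw [norm_mul]
      have := norm_nonneg z
      nlinarith
  have hconst : ∀ z : ℂ, ρ < ‖q * z‖ → ‖z‖ < R → f z = circleAverage f 0 ‖z‖ := by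
    intro z hz hz'
    have hz0 : 0 < ‖z‖ := hρ.trans_lt (hlt hz)
    have hcs : ContinuousOn f (Metric.sphere 0 ‖z‖) := hf.continuousOn.mono fun w hw => by
      have hw' : ‖w‖ = ‖z‖ := by simpa using hw
      simpa [hw'] using And.intro (hlt hz) hz'
    refine sub_eq_zero.mp (eq_zero_of_circleAverage_zpow_mul
      (f := fun w => f w - circleAverage f 0 ‖z‖) hz0 (hcs.sub continuousOn_const) (fun n => ?_) rfl)
    have hpow : ContinuousOn (fun w : ℂ => w ^ n) (Metric.sphere 0 ‖z‖) := fun w hw =>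
      (continuousAt_zpow₀ w n (Or.inl (by
        rintro rfl
        simp at hw
        exact hz0.ne' (by simpa using hw.symm)))).continuousWithinAt
    simp only [mul_sub]
    rw [circleAverage_fun_sub (f₁ := fun w => w ^ n * f w)
      (f₂ := fun w => w ^ n * circleAverage f 0 ‖z‖) ((hpow.mul hcs).circleIntegrable hz0.le)
      ((hpow.mul continuousOn_const).circleIntegrable hz0.le)]
    rcases eq_or_ne n 0 with rfl | hn
    · simp [circleAverage_const]
    · rw [hcoef z hz hz' n hn]
      have h1 : circleAverage (fun w => w ^ n * circleAverage f 0 ‖z‖) 0 ‖z‖ =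
          circleAverage f 0 ‖z‖ * circleAverage (fun w => w ^ n) 0 ‖z‖ := by
        rw [← smul_eq_mul, ← circleAverage_fun_smul]
        exact circleAverage_congr_sphere fun w _ => by simp [mul_comm]
      have h2 : circleIntegral (fun w : ℂ => (w - 0)⁻¹ • w ^ n) 0 ‖z‖ = 0 := by
        refine Eq.trans ?_
          (circleIntegral.integral_sub_zpow_of_ne (n := n - 1) (by omega) 0 0 ‖z‖)
        refine circleIntegral.integral_congr hz0.le fun w hw => ?_
        have hw0 : w ≠ 0 := norm_pos_iff.mp (by simpa [show ‖w‖ = ‖z‖ by simpa using hw] using hz0)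
        simp only [sub_zero, smul_eq_mul]
        rw [zpow_sub_one₀ hw0, mul_comm]
      rw [h1, circleAverage_eq_circleIntegral (f := fun w : ℂ => w ^ n) hz0.ne', h2]
      simp
  rw [hconst x hx hx', hconst y hy hy']
  have := circleAverage_zpow_mul_eq hf hρ 0 (hlt hx) hx' (hlt hy) hy'
  simpa using this

/-! ### Parameter dependence of averages and the Poisson kernel -/

open Real in
/-- An average over the unit circle depends holomorphically on a parameter. -/
theorem differentiableOn_circleAverage {U : Set ℂ} (hU : IsOpen U) {Φ : ℂ → ℂ → ℂ}
    (hc : ContinuousOn (fun x : ℂ × ℂ => Φ x.1 x.2) (U ×ˢ Metric.sphere 0 1))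
    (hd : ∀ z : ℂ, ‖z‖ = 1 → DifferentiableOn ℂ (fun s => Φ s z) U) :
    DifferentiableOn ℂ (fun s => circleAverage (Φ s) 0 1) U := by
  intro s₀ hs₀
  obtain ⟨δ, hδ, hball⟩ := Metric.nhds_basis_closedBall.mem_iff.mp (hU.mem_nhds hs₀)
  have hcirc : ∀ θ : ℝ, circleMap 0 1 θ ∈ Metric.sphere (0 : ℂ) 1 :=
    fun θ => circleMap_mem_sphere 0 zero_le_one θ
  have hnorm : ∀ θ : ℝ, ‖circleMap 0 1 θ‖ = 1 := fun θ => by simp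
  obtain ⟨M, hM⟩ := ((isCompact_closedBall s₀ δ).prod
    (isCompact_sphere (0 : ℂ) 1)).exists_bound_of_continuousOn
    (hc.mono (Set.prod_mono hball subset_rfl))
  have hcont : ∀ s ∈ U, Continuous fun θ : ℝ => Φ s (circleMap 0 1 θ) := fun s hs =>
    hc.comp_continuous (f := fun θ : ℝ => (s, circleMap 0 1 θ))
      (by fun_prop) fun θ => ⟨hs, hcirc θ⟩
  have hderiv : ∀ θ : ℝ, ∀ s ∈ U, HasDerivAt (fun s => Φ s (circleMap 0 1 θ))
      (deriv (fun s => Φ s (circleMap 0 1 θ)) s) s := fun θ s hs =>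
    ((hd _ (hnorm θ)).differentiableAt (hU.mem_nhds hs)).hasDerivAt
  have hhalf : Metric.ball s₀ (δ / 2) ∈ nhds s₀ := Metric.ball_mem_nhds _ (by positivity)
  have hmeas : MeasureTheory.AEStronglyMeasurable
      (fun θ : ℝ => deriv (fun s => Φ s (circleMap 0 1 θ)) s₀)
      (MeasureTheory.volume.restrict (Set.uIoc 0 (2 * π))) := by
    have hu : Filter.Tendsto (fun n : ℕ => (((δ / 2) / (n + 1) : ℝ) : ℂ)) Filter.atTop (nhds 0) := by
      have := tendsto_const_div_atTop_nhds_zero_nat (δ / 2)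
      have h2 := (Filter.tendsto_add_atTop_iff_nat 1).mpr this
      have h3 := (Complex.continuous_ofReal.tendsto 0).comp h2
      simpa [Function.comp_def] using h3
    have hpos : ∀ n : ℕ, 0 < (δ / 2) / ((n : ℝ) + 1) := fun n => by positivity
    have hmem : ∀ n : ℕ, s₀ + (((δ / 2) / (n + 1) : ℝ) : ℂ) ∈ U := fun n => hball (by
      rw [Metric.mem_closedBall, dist_eq_norm, add_sub_cancel_left, Complex.norm_real,
        Real.norm_of_nonneg (hpos n).le, div_le_iff₀ (by positivity)]
      nlinarith [Nat.cast_nonneg (α := ℝ) n])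
    -- the derivative is a limit of difference quotients, which are continuous in `θ`
    refine aestronglyMeasurable_of_tendsto_ae (u := Filter.atTop)
      (f := fun (n : ℕ) (θ : ℝ) => (((δ / 2) / (n + 1) : ℝ) : ℂ)⁻¹ •
        (Φ (s₀ + (((δ / 2) / (n + 1) : ℝ) : ℂ)) (circleMap 0 1 θ) - Φ s₀ (circleMap 0 1 θ)))
      (fun n => ?_) (Filter.Eventually.of_forall fun θ => ?_)
    · exact (((hcont _ (hmem n)).sub (hcont _ hs₀)).const_smul
        ((((δ / 2) / (n + 1) : ℝ) : ℂ)⁻¹)).aestronglyMeasurable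
    · refine (hasDerivAt_iff_tendsto_slope_zero.mp (hderiv θ s₀ hs₀)).comp
        (tendsto_nhdsWithin_iff.mpr ⟨hu, Filter.Eventually.of_forall fun n => ?_⟩)
      exact Complex.ofReal_ne_zero.mpr (hpos n).ne'
  have key := intervalIntegral.hasDerivAt_integral_of_dominated_loc_of_deriv_le
    (μ := MeasureTheory.volume) (a := 0) (b := 2 * π)
    (F := fun s θ => Φ s (circleMap 0 1 θ))
    (F' := fun s θ => deriv (fun s => Φ s (circleMap 0 1 θ)) s) (x₀ := s₀)
    (bound := fun _ => M / (δ / 2)) hhalf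
    (Filter.eventually_of_mem (hU.mem_nhds hs₀) fun s hs => (hcont s hs).aestronglyMeasurable)
    ((hcont s₀ hs₀).intervalIntegrable _ _) hmeas
    (Filter.Eventually.of_forall fun θ _ s hs => ?_) intervalIntegrable_const
    (Filter.Eventually.of_forall fun θ _ s hs => hderiv θ s (hball ?_))
  · exact ((key.2.const_smul ((2 * π)⁻¹ : ℝ)).differentiableAt).differentiableWithinAt
  · have hsub : Metric.closedBall s (δ / 2) ⊆ Metric.closedBall s₀ δ := by
      refine Metric.closedBall_subset_closedBall' ?_
      have := (Metric.mem_ball.mp hs).le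
      linarith
    refine Complex.norm_deriv_le_of_forall_mem_sphere_norm_le (by positivity)
      (((hd _ (hnorm θ)).mono (hsub.trans hball)).diffContOnCl_ball subset_rfl) fun w hw => ?_
    exact hM (w, circleMap 0 1 θ) ⟨hsub (Metric.sphere_subset_closedBall hw), hcirc θ⟩
  · exact Metric.ball_subset_closedBall (Metric.ball_subset_ball (by linarith) hs)

/-- Two continuous functions that agree off a countable set agree everywhere. -/
theorem eqOn_of_eq_off_countable {f g : ℂ → ℂ} {U S : Set ℂ} (hU : IsOpen U) (hS : S.Countable)
    (hf : ContinuousOn f U) (hg : ContinuousOn g U) (h : ∀ z ∈ U, z ∉ S → f z = g z) :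
    Set.EqOn f g U := by
  intro z hz
  by_contra hne
  have hV : IsOpen (U ∩ {w | w ∈ U → f w ≠ g w}) := by
    have h1 : U ∩ {w | w ∈ U → f w ≠ g w} = U ∩ (fun w => f w - g w) ⁻¹' {0}ᶜ := by
      ext w
      simp +contextual [sub_eq_zero]
    rw [h1]
    exact (hf.sub hg).isOpen_inter_preimage hU isOpen_compl_singleton
  obtain ⟨w, hw, hwS⟩ := (hS.dense_compl ℝ).inter_open_nonempty _ hV ⟨z, hz, fun _ => hne⟩
  exact hw.2 hw.1 (h w hw.1 hwS)

open Real in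
/-- The Poisson kernel at radius `s` in the variable `z²`, with peaks at `±i`, has mean one. -/
theorem circleAverage_poisson_sq {s : ℝ} (hs0 : 0 ≤ s) (hs : s < 1) :
    circleAverage (fun z => (((1 - s ^ 2) / ‖1 + s * z ^ 2‖ ^ 2 : ℝ) : ℂ)) 0 1 = 1 := by
  have hne : ∀ z : ℂ, ‖z‖ ≤ 1 → 1 + s * z ^ 2 ≠ 0 := fun z hz h => by
    have h1 : ‖(s : ℂ) * z ^ 2‖ < 1 := by
      rw [norm_mul, norm_pow, Complex.norm_real, Real.norm_of_nonneg hs0]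
      have := pow_le_one₀ (n := 2) (norm_nonneg z) hz
      nlinarith [norm_nonneg z]
    rw [eq_neg_of_add_eq_zero_right h] at h1
    simp at h1
  have hd : DifferentiableOn ℂ (fun z : ℂ => (1 + s * z ^ 2)⁻¹) (Metric.closedBall 0 1) :=
    fun z hz => (DifferentiableAt.fun_inv (𝕜 := ℂ) (h := fun z : ℂ => 1 + s * z ^ 2) (by fun_prop)
      (hne z (by simpa using hz))).differentiableWithinAt
  have h1 : circleAverage (fun z : ℂ => (1 + s * z ^ 2)⁻¹) 0 1 = 1 := by
    rw [circleAverage_of_differentiable_on_off_countable Set.countable_empty]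
    · simp
    · simpa using hd.continuousOn
    · intro z hz
      exact hd.differentiableAt (Filter.mem_of_superset (Metric.isOpen_ball.mem_nhds
        (by simpa using hz.1)) Metric.ball_subset_closedBall)
  have h2 : circleAverage (fun z : ℂ => (1 + s * z⁻¹ ^ 2)⁻¹) 0 1 = 1 :=
    (circleAverage_zero_one_congr_inv (f := fun z : ℂ => (1 + s * z ^ 2)⁻¹)).trans h1
  have hsph : ∀ z ∈ Metric.sphere (0 : ℂ) |1|, ‖z‖ = 1 := fun z hz => by simpa using hz
  have hci : CircleIntegrable (fun z : ℂ => (1 + s * z ^ 2)⁻¹) 0 1 :=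
    (hd.continuousOn.mono Metric.sphere_subset_closedBall).circleIntegrable zero_le_one
  have hci' : CircleIntegrable (fun z : ℂ => (1 + s * z⁻¹ ^ 2)⁻¹) 0 1 := by
    refine ContinuousOn.circleIntegrable zero_le_one fun z hz => ?_
    have hz1 : ‖z‖ = 1 := by simpa using hz
    have hz0 : z ≠ 0 := norm_pos_iff.mp (by simp [hz1])
    refine (ContinuousAt.fun_inv₀ (f := fun z : ℂ => 1 + s * z⁻¹ ^ 2)
      (by fun_prop (disch := assumption)) (hne _ ?_)).continuousWithinAt
    simp [hz1]
  calc _ = circleAverage (fun z : ℂ => (1 + s * z ^ 2)⁻¹ + (1 + s * z⁻¹ ^ 2)⁻¹ - 1) 0 1 := by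
        refine circleAverage_congr_sphere fun z hz => ?_
        have hz1 := hsph z hz
        have hz0 : z ≠ 0 := norm_pos_iff.mp (by simp [hz1])
        have hconj : (starRingEnd ℂ) z = z⁻¹ := by
          rw [Complex.inv_def, Complex.normSq_eq_norm_sq, hz1]; simp
        have hn : (((‖1 + s * z ^ 2‖ ^ 2 : ℝ)) : ℂ) = (1 + s * z ^ 2) * (1 + s * z⁻¹ ^ 2) := by
          rw [← Complex.normSq_eq_norm_sq, Complex.normSq_eq_conj_mul_self]
          simp [hconj, mul_comm]
        have ha := hne z hz1.le
        have hb := hne z⁻¹ (by simp [hz1])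
        rw [Complex.ofReal_div, hn]
        have hab : ((1 : ℂ) - s ^ 2) = (1 + s * z⁻¹ ^ 2) + (1 + s * z ^ 2)
            - (1 + s * z ^ 2) * (1 + s * z⁻¹ ^ 2) := by
          field_simp
          ring
        push_cast
        rw [hab, sub_div, add_div, div_self (mul_ne_zero ha hb), div_mul_cancel_right₀ hb,
          div_mul_cancel_left₀ ha]
    _ = 1 := by
        rw [circleAverage_fun_sub (f₁ := fun z : ℂ => (1 + s * z ^ 2)⁻¹ + (1 + s * z⁻¹ ^ 2)⁻¹)
          (hci.add hci') (circleIntegrable_const _ _ _),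
          circleAverage_fun_add hci hci', h1, h2, circleAverage_const]
        norm_num

open Real Filter Topology in
/-- As `s → 1` the Poisson kernel in the variable `z²` concentrates at the two points with `z² =
-1`. If the continuous function `H 1` takes the same value `L` at both, the averages tend to `L`;
it does not matter how the mass splits between the two points. -/
theorem tendsto_circleAverage_poisson_sq {H : ℝ → ℂ → ℂ} {a : ℝ} (ha0 : 0 ≤ a) (ha : a < 1) {L : ℂ}
    (hH : ContinuousOn (fun x : ℝ × ℂ => H x.1 x.2) (Set.Icc a 1 ×ˢ Metric.sphere 0 1))
    (hL : ∀ z : ℂ, z ^ 2 = -1 → H 1 z = L) :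
    Tendsto (fun s : ℝ => circleAverage
      (fun z => (((1 - s ^ 2) / ‖1 + s * z ^ 2‖ ^ 2 : ℝ) : ℂ) * H s z) 0 1) (𝓝[<] 1) (𝓝 L) := by
  set K : Set (ℝ × ℂ) := Set.Icc a 1 ×ˢ Metric.sphere 0 1 with hK
  have hKc : IsCompact K := isCompact_Icc.prod (isCompact_sphere _ _)
  have hG : ContinuousOn (fun x : ℝ × ℂ => H x.1 x.2 - L) K := hH.sub continuousOn_const
  obtain ⟨M, hM⟩ := hKc.exists_bound_of_continuousOn hG
  have hM0 : 0 ≤ M := (norm_nonneg _).trans (hM (1, 1) ⟨⟨ha.le, le_rfl⟩, by simp⟩)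
  rw [Metric.tendsto_nhds]
  intro ε hε
  -- away from the two peaks `z² = -1` at `s = 1`, the quantity `(1 - s) + |1 + z²|` is bounded below
  obtain ⟨δ, hδ, hδK⟩ : ∃ δ > 0, ∀ x ∈ K, ε / 2 ≤ ‖H x.1 x.2 - L‖ →
      δ ≤ (1 - x.1) + ‖1 + x.2 ^ 2‖ := by
    have hclosed : IsCompact (K ∩ (fun x : ℝ × ℂ => ‖H x.1 x.2 - L‖) ⁻¹' Set.Ici (ε / 2)) :=
      hKc.of_isClosed_subset (hG.norm.preimage_isClosed_of_isClosed hKc.isClosed isClosed_Ici)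
        Set.inter_subset_left
    rcases Set.eq_empty_or_nonempty (K ∩ (fun x : ℝ × ℂ => ‖H x.1 x.2 - L‖) ⁻¹' Set.Ici (ε / 2))
      with he | hne
    · exact ⟨1, one_pos, fun x hx hx' => absurd (he.subset ⟨hx, hx'⟩) (Set.notMem_empty x)⟩
    · obtain ⟨x, hx, hmin⟩ := hclosed.exists_isMinOn hne
        (f := fun x : ℝ × ℂ => (1 - x.1) + ‖1 + x.2 ^ 2‖) (by fun_prop)
      refine ⟨(1 - x.1) + ‖1 + x.2 ^ 2‖, ?_, fun y hy hy' => hmin ⟨hy, hy'⟩⟩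
      have h1 : 0 ≤ 1 - x.1 := sub_nonneg.mpr hx.1.1.2
      refine lt_of_le_of_ne (by positivity) fun h0 => ?_
      have h2 : x.1 = 1 := by linarith [norm_nonneg (1 + x.2 ^ 2)]
      have h3 : 1 + x.2 ^ 2 = 0 := norm_eq_zero.mp (by linarith)
      have h4 : ε / 2 ≤ ‖H x.1 x.2 - L‖ := hx.2
      rw [h2, hL x.2 (by linear_combination h3), sub_self, norm_zero] at h4
      linarith
  have hev : ∀ᶠ s in 𝓝[<] (1 : ℝ), a < s ∧ s < 1 ∧ 1 - s < δ / 4 ∧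
      (1 - s ^ 2) / (δ / 2) ^ 2 * M < ε / 2 := by
    have h1 : ∀ᶠ s in 𝓝[<] (1 : ℝ), a < s := nhdsWithin_le_nhds (lt_mem_nhds ha)
    have h2 : ∀ᶠ s in 𝓝[<] (1 : ℝ), s < 1 := self_mem_nhdsWithin
    have h3 : ∀ᶠ s in 𝓝[<] (1 : ℝ), 1 - δ / 4 < s := nhdsWithin_le_nhds (lt_mem_nhds (by linarith))
    have h4 : ∀ᶠ s in 𝓝[<] (1 : ℝ), (1 - s ^ 2) / (δ / 2) ^ 2 * M < ε / 2 := by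
      have : Tendsto (fun s : ℝ => (1 - s ^ 2) / (δ / 2) ^ 2 * M) (𝓝 1) (𝓝 0) := by
        have : Continuous (fun s : ℝ => (1 - s ^ 2) / (δ / 2) ^ 2 * M) := by fun_prop
        simpa using this.tendsto 1
      exact nhdsWithin_le_nhds (this (gt_mem_nhds (by positivity)))
    filter_upwards [h1, h2, h3, h4] with s h1 h2 h3 h4 using ⟨h1, h2, by linarith, h4⟩
  filter_upwards [hev] with s ⟨has, hs1, hsδ, hsM⟩
  have hs0 : 0 < s := ha0.trans_lt has
  set N : ℂ → ℝ := fun z => (1 - s ^ 2) / ‖1 + s * z ^ 2‖ ^ 2 with hN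
  have hpos : 0 ≤ 1 - s ^ 2 := by nlinarith
  have hne : ∀ z : ℂ, ‖z‖ = 1 → 1 + s * z ^ 2 ≠ 0 := fun z hz h => by
    have h1 : ‖(s : ℂ) * z ^ 2‖ < 1 := by
      rw [norm_mul, norm_pow, Complex.norm_real, Real.norm_of_nonneg hs0.le, hz]
      simpa using hs1
    rw [eq_neg_of_add_eq_zero_right h] at h1
    simp at h1
  have hNc : ContinuousOn N (Metric.sphere 0 1) := by
    refine ContinuousOn.div (by fun_prop) (by fun_prop) fun z hz => ?_
    simpa using hne z (by simpa using hz)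
  have hNc' : ContinuousOn (fun z => (N z : ℂ)) (Metric.sphere 0 1) :=
    Complex.continuous_ofReal.comp_continuousOn hNc
  have hGs : ContinuousOn (fun z => H s z - L) (Metric.sphere 0 1) :=
    hG.comp (f := fun z : ℂ => (s, z)) (by fun_prop) fun z hz => ⟨⟨has.le, hs1.le⟩, hz⟩
  have hHs : ContinuousOn (fun z => H s z) (Metric.sphere 0 1) :=
    hH.comp (f := fun z : ℂ => (s, z)) (by fun_prop) fun z hz => ⟨⟨has.le, hs1.le⟩, hz⟩
  have hmass := circleAverage_poisson_sq hs0.le hs1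
  have hmassR : circleAverage N 0 1 = 1 := by
    have h := ContinuousLinearMap.circleAverage_comp_comm Complex.reCLM
      (hNc'.circleIntegrable zero_le_one)
    rw [hmass] at h
    simpa [Function.comp_def] using h
  have hdiff : circleAverage (fun z => (N z : ℂ) * H s z) 0 1 - L =
      circleAverage (fun z => (N z : ℂ) * (H s z - L)) 0 1 := by
    simp only [mul_sub]
    rw [circleAverage_fun_sub (f₁ := fun z => (N z : ℂ) * H s z) (f₂ := fun z => (N z : ℂ) * L)
      ((hNc'.mul hHs).circleIntegrable zero_le_one)
      ((hNc'.mul continuousOn_const).circleIntegrable zero_le_one)]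
    congr 1
    have h1 : circleAverage (fun z => (N z : ℂ) * L) 0 1 = L * circleAverage (fun z => (N z : ℂ)) 0 1 := by
      rw [← smul_eq_mul, ← circleAverage_fun_smul]
      simp only [smul_eq_mul, mul_comm]
    rw [h1, hmass, mul_one]
  rw [dist_eq_norm, hdiff]
  have hbound : ∀ z ∈ Metric.sphere (0 : ℂ) |1|, ‖(N z : ℂ) * (H s z - L)‖ ≤
      N z * (ε / 2) + (1 - s ^ 2) / (δ / 2) ^ 2 * M := by
    intro z hz
    have hz' : z ∈ Metric.sphere (0 : ℂ) 1 := by simpa using hz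
    have hz1 : ‖z‖ = 1 := by simpa using hz
    have hzK : (s, z) ∈ K := ⟨⟨has.le, hs1.le⟩, hz'⟩
    have hN0 : 0 ≤ N z := div_nonneg hpos (by positivity)
    rw [norm_mul, Complex.norm_real, Real.norm_of_nonneg hN0]
    rcases lt_or_ge ‖H s z - L‖ (ε / 2) with hlt | hge
    · have h1 : 0 ≤ (1 - s ^ 2) / (δ / 2) ^ 2 * M := by positivity
      have h2 := mul_le_mul_of_nonneg_left hlt.le hN0
      linarith
    · have h1 : δ ≤ (1 - s) + ‖1 + z ^ 2‖ := hδK (s, z) hzK hge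
      have h2 : ‖1 + z ^ 2‖ ≤ ‖1 + s * z ^ 2‖ + (1 - s) := by
        have h3 : 1 + z ^ 2 = (1 + s * z ^ 2) + ((1 - s : ℝ) : ℂ) * z ^ 2 := by push_cast; ring
        calc ‖1 + z ^ 2‖ ≤ ‖1 + s * z ^ 2‖ + ‖((1 - s : ℝ) : ℂ) * z ^ 2‖ := by
              rw [h3]; exact norm_add_le _ _
          _ = _ := by
              rw [norm_mul, norm_pow, hz1, Complex.norm_real, Real.norm_of_nonneg (by linarith)]
              ring
      have h3 : δ / 2 ≤ ‖1 + s * z ^ 2‖ := by linarith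
      have h4 : N z ≤ (1 - s ^ 2) / (δ / 2) ^ 2 := by
        simp only [hN]
        gcongr
      have h5 : N z * ‖H s z - L‖ ≤ (1 - s ^ 2) / (δ / 2) ^ 2 * M := by
        gcongr
        exact hM (s, z) hzK
      have h6 : 0 ≤ N z * (ε / 2) := by positivity
      linarith
  calc ‖circleAverage (fun z => (N z : ℂ) * (H s z - L)) 0 1‖
      ≤ circleAverage (fun z => ‖(N z : ℂ) * (H s z - L)‖) 0 1 := by
        rw [circleAverage, circleAverage, norm_smul, smul_eq_mul,
          Real.norm_of_nonneg (inv_nonneg.mpr two_pi_pos.le)]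
        gcongr
        exact intervalIntegral.norm_integral_le_integral_norm two_pi_pos.le
    _ ≤ circleAverage (fun z => N z * (ε / 2) + (1 - s ^ 2) / (δ / 2) ^ 2 * M) 0 1 :=
        circleAverage_mono ((hNc'.mul hGs).norm.circleIntegrable zero_le_one)
          (((hNc.mul continuousOn_const).add continuousOn_const).circleIntegrable zero_le_one) hbound
    _ = ε / 2 + (1 - s ^ 2) / (δ / 2) ^ 2 * M := by
        rw [circleAverage_fun_add (f₁ := fun z => N z * (ε / 2))
          ((hNc.mul continuousOn_const).circleIntegrable zero_le_one)
          (circleIntegrable_const _ _ _), circleAverage_const]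
        have h1 : circleAverage (fun z => N z * (ε / 2)) 0 1 = (ε / 2) * circleAverage N 0 1 := by
          rw [← smul_eq_mul, ← circleAverage_fun_smul]
          simp only [smul_eq_mul, mul_comm]
        rw [h1, hmassR, mul_one]
    _ < ε := by linarith

/-! ### The infinite products -/

theorem differentiable_tprod_one_sub_mul {ι : Type*} {a : ι → ℂ} (ha : Summable fun i => ‖a i‖) :
    Differentiable ℂ fun z => ∏' i, (1 - z * a i) := by
  intro z₀
  have hprod : HasProdLocallyUniformlyOn (fun i (z : ℂ) => 1 + -(z * a i))
      (fun z => ∏' i, (1 + -(z * a i))) (Metric.ball 0 (‖z₀‖ + 1)) := by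
    refine Summable.hasProdLocallyUniformlyOn_one_add Metric.isOpen_ball (ha.mul_left (‖z₀‖ + 1))
      (.of_forall fun i z hz => ?_) fun i => by fun_prop
    rw [norm_neg, norm_mul]
    gcongr
    simpa using (Metric.mem_ball.mp hz).le
  have hd : DifferentiableOn ℂ (fun z => ∏' i, (1 + -(z * a i))) (Metric.ball 0 (‖z₀‖ + 1)) :=
    hprod.differentiableOn (.of_forall fun s => by
      simpa [Finset.prod_fn] using DifferentiableOn.finsetProd (fun _ _ => by fun_prop))
      Metric.isOpen_ball
  simp only [← sub_eq_add_neg] at hd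
  exact hd.differentiableAt (Metric.isOpen_ball.mem_nhds (by simp))

theorem tprod_one_sub_mul_ne_zero {ι : Type*} {a : ι → ℂ} (ha : Summable fun i => ‖a i‖) {z : ℂ}
    (hz : ∀ i, z * a i ≠ 1) : ∏' i, (1 - z * a i) ≠ 0 := by
  simp only [sub_eq_add_neg]
  refine tprod_one_add_ne_zero_of_summable (fun i => ?_) ?_
  · rw [← sub_eq_add_neg]
    exact sub_ne_zero.mpr (hz i).symm
  · simpa [norm_mul] using ha.mul_left ‖z‖

theorem summable_norm_pow_mul_pow {p q : ℂ} (hp : ‖p‖ < 1) (hq : ‖q‖ < 1) :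
    Summable fun jk : ℕ × ℕ => ‖p ^ jk.1 * q ^ jk.2‖ := by
  have h := (summable_norm_geometric_of_norm_lt_one hp).mul_of_nonneg
    (summable_norm_geometric_of_norm_lt_one hq) (fun _ => norm_nonneg _) fun _ => norm_nonneg _
  simpa only [norm_mul] using h

theorem differentiable_qShifted {q : ℂ} (hq : ‖q‖ < 1) : Differentiable ℂ fun z => qShifted z q :=
  differentiable_tprod_one_sub_mul (summable_norm_geometric_of_norm_lt_one hq)

theorem differentiable_pqShifted {p q : ℂ} (hp : ‖p‖ < 1) (hq : ‖q‖ < 1) :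
    Differentiable ℂ fun z => pqShifted z p q := by
  simpa only [pqShifted, mul_assoc] using
    differentiable_tprod_one_sub_mul (summable_norm_pow_mul_pow hp hq)

theorem qShifted_ne_zero {z q : ℂ} (hq : ‖q‖ < 1) (hz : ∀ j : ℕ, z * q ^ j ≠ 1) :
    qShifted z q ≠ 0 :=
  tprod_one_sub_mul_ne_zero (summable_norm_geometric_of_norm_lt_one hq) hz

theorem qShifted_ne_zero_of_norm_lt_one {z q : ℂ} (hq : ‖q‖ < 1) (hz : ‖z‖ < 1) :
    qShifted z q ≠ 0 := by
  refine qShifted_ne_zero hq fun j h => ?_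
  have h1 : ‖z * q ^ j‖ < 1 := by
    rw [norm_mul, norm_pow]
    exact mul_lt_one_of_nonneg_of_lt_one_left (norm_nonneg _) hz (pow_le_one₀ (norm_nonneg _) hq.le)
  rw [h, norm_one] at h1
  exact lt_irrefl _ h1

theorem pqShifted_ne_zero_of_norm_lt_one {z p q : ℂ} (hp : ‖p‖ < 1) (hq : ‖q‖ < 1) (hz : ‖z‖ < 1) :
    pqShifted z p q ≠ 0 := by
  have h : ∏' jk : ℕ × ℕ, (1 - z * (p ^ jk.1 * q ^ jk.2)) ≠ 0 := by
    refine tprod_one_sub_mul_ne_zero (summable_norm_pow_mul_pow hp hq) fun jk h => ?_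
    have h1 : ‖z * (p ^ jk.1 * q ^ jk.2)‖ < 1 := by
      rw [norm_mul, norm_mul, norm_pow, norm_pow]
      exact mul_lt_one_of_nonneg_of_lt_one_left (norm_nonneg _) hz
        (mul_le_one₀ (pow_le_one₀ (norm_nonneg _) hp.le) (by positivity)
          (pow_le_one₀ (norm_nonneg _) hq.le))
    rw [h, norm_one] at h1
    exact lt_irrefl _ h1
  simpa only [pqShifted, mul_assoc] using h

theorem qShifted_eq_one_sub_mul (z : ℂ) {q : ℂ} (hq : ‖q‖ < 1) :
    qShifted z q = (1 - z) * qShifted (q * z) q := by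
  have h : Multipliable fun j : ℕ => 1 - z * q ^ (j + 1) := by
    simpa only [pow_succ', mul_comm, mul_left_comm, mul_assoc] using
      multipliable_qShifted (q * z) hq
  rw [qShifted, tprod_eq_zero_mul' (f := fun j : ℕ => 1 - z * q ^ j) h, qShifted, pow_zero, mul_one]
  congr 2
  funext j
  ring

theorem pqShifted_swap (z : ℂ) {p q : ℂ} : pqShifted z p q = pqShifted z q p := by
  rw [pqShifted, pqShifted, ← (Equiv.prodComm ℕ ℕ).tprod_eq]
  refine tprod_congr fun jk => ?_
  simp only [Equiv.prodComm_apply, Prod.fst_swap, Prod.snd_swap]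
  ring

/-- Splitting off the factors without `p`: `(z; p, q)_∞ = (z; q)_∞ (p z; p, q)_∞`. -/
theorem pqShifted_eq_qShifted_mul (z : ℂ) {p q : ℂ} (hp : ‖p‖ < 1) (hq : ‖q‖ < 1) :
    pqShifted z p q = qShifted z q * pqShifted (p * z) p q := by
  have hrow : ∀ w : ℂ, HasProd (fun j : ℕ => qShifted (w * p ^ j) q) (pqShifted w p q) := fun w =>
    (multipliable_pqShifted w hp hq).hasProd.prod_fiberwise fun j =>
      (multipliable_qShifted (w * p ^ j) hq).hasProd
  have hshift : ∀ j : ℕ, p * z * p ^ j = z * p ^ (j + 1) := fun j => by ring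
  have h := hrow (p * z)
  simp only [hshift] at h
  rw [← (hrow z).tprod_eq, tprod_eq_zero_mul' (f := fun j : ℕ => qShifted (z * p ^ j) q)
    h.multipliable, h.tprod_eq, pow_zero, mul_one]

/-- Splitting off the factors without `q`: `(z; p, q)_∞ = (z; p)_∞ (q z; p, q)_∞`. -/
theorem pqShifted_eq_qShifted_mul' (z : ℂ) {p q : ℂ} (hp : ‖p‖ < 1) (hq : ‖q‖ < 1) :
    pqShifted z p q = qShifted z p * pqShifted (q * z) p q := by
  rw [pqShifted_swap, pqShifted_eq_qShifted_mul z hq hp, pqShifted_swap]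

/-! ### Theta functions -/

/-- The multiplicative theta function `θ(z; p) = (z; p)_∞ (p / z; p)_∞`. -/
noncomputable def theta (p z : ℂ) : ℂ :=
  qShifted z p * qShifted (p * z⁻¹) p

section Theta

variable {p : ℂ}

theorem theta_eq (hp : ‖p‖ < 1) (z : ℂ) :
    theta p z = (1 - z) * (qShifted (p * z) p * qShifted (p * z⁻¹) p) := by
  rw [theta, qShifted_eq_one_sub_mul z hp, mul_assoc]

theorem theta_one (hp : ‖p‖ < 1) : theta p 1 = 0 := by
  rw [theta_eq hp, sub_self, zero_mul]

theorem theta_inv (hp : ‖p‖ < 1) {z : ℂ} (hz : z ≠ 0) : theta p z⁻¹ = -z⁻¹ * theta p z := by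
  rw [theta_eq hp, theta_eq hp, inv_inv]
  field_simp
  ring

theorem theta_div_self (hp0 : p ≠ 0) (z : ℂ) : theta p (p * z⁻¹) = theta p z := by
  rw [theta, theta, mul_inv, inv_inv, mul_inv_cancel_left₀ hp0, mul_comm]

/-- The quasi-periodicity `θ(p z; p) = -z⁻¹ θ(z; p)`. -/
theorem theta_mul_self (hp : ‖p‖ < 1) (hp0 : p ≠ 0) {z : ℂ} (hz : z ≠ 0) :
    theta p (p * z) = -z⁻¹ * theta p z := by
  rw [← theta_inv hp hz, ← theta_div_self hp0 z⁻¹, inv_inv]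

theorem theta_ne_zero (hp : ‖p‖ < 1) (hp0 : p ≠ 0) {z : ℂ} (hz : z ≠ 0)
    (h : ∀ k : ℤ, z ≠ p ^ k) : theta p z ≠ 0 := by
  refine mul_ne_zero (qShifted_ne_zero hp fun j hj => h (-j) ?_)
    (qShifted_ne_zero hp fun j hj => h (j + 1) ?_)
  · rw [zpow_neg, zpow_natCast]
    exact eq_inv_of_mul_eq_one_left hj
  · rw [zpow_add_one₀ hp0, zpow_natCast]
    field_simp at hj
    linear_combination -hj

@[fun_prop]
theorem DifferentiableAt.theta_comp {f : ℂ → ℂ} {z : ℂ} (hp : ‖p‖ < 1) (hf : DifferentiableAt ℂ f z)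
    (h0 : f z ≠ 0) : DifferentiableAt ℂ (fun w => theta p (f w)) z :=
  ((differentiable_qShifted hp _).comp z hf).mul
    ((differentiable_qShifted hp _).comp z ((hf.inv h0).const_mul p))

theorem differentiableOn_theta (hp : ‖p‖ < 1) : DifferentiableOn ℂ (theta p) {0}ᶜ := fun _ hz =>
  (DifferentiableAt.theta_comp (f := fun z => z) hp differentiableAt_id hz).differentiableWithinAt

/-- Theta functions of degree two with multiplier `K`: holomorphic functions on `ℂ ∖ {0}` with
`φ(p x) = K x⁻² φ(x)`. -/
structure IsThetaTwo (p K : ℂ) (φ : ℂ → ℂ) : Prop where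
  diff : DifferentiableOn ℂ φ {0}ᶜ
  mul_left : ∀ x, x ≠ 0 → φ (p * x) = K * (x ^ 2)⁻¹ * φ x

namespace IsThetaTwo

variable {K : ℂ} {φ ψ : ℂ → ℂ}

theorem add (hφ : IsThetaTwo p K φ) (hψ : IsThetaTwo p K ψ) : IsThetaTwo p K fun x => φ x + ψ x :=
  ⟨hφ.diff.add hψ.diff, fun x hx => by rw [hφ.mul_left x hx, hψ.mul_left x hx]; ring⟩

theorem const_mul (c : ℂ) (hφ : IsThetaTwo p K φ) : IsThetaTwo p K fun x => c * φ x :=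
  ⟨hφ.diff.const_mul c, fun x hx => by rw [hφ.mul_left x hx]; ring⟩

theorem sub (hφ : IsThetaTwo p K φ) (hψ : IsThetaTwo p K ψ) : IsThetaTwo p K fun x => φ x - ψ x :=
  ⟨hφ.diff.sub hψ.diff, fun x hx => by rw [hφ.mul_left x hx, hψ.mul_left x hx]; ring⟩

open Real in
theorem circleAverage_zpow_mul (hφ : IsThetaTwo p K φ) (n : ℤ) {R : ℝ} (hR : 0 < R) :
    circleAverage (fun z => z ^ n * φ z) 0 R = circleAverage (fun z => z ^ n * φ z) 0 1 :=
  circleAverage_zpow_mul_eq (ρ := 0) (R := R + 2)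
    (hφ.diff.mono fun z hz => norm_pos_iff.mp hz.1) le_rfl n hR (by linarith) one_pos (by linarith)

open Real in
/-- The multiplier ties each Laurent coefficient of a theta function of degree two to the next but
one. -/
theorem circleAverage_rec (hφ : IsThetaTwo p K φ) (hp0 : p ≠ 0) (n : ℤ) :
    circleAverage (fun z => z ^ n * φ z) 0 1 =
      K * p ^ n * circleAverage (fun z => z ^ (n - 2) * φ z) 0 1 := by
  have h := circleAverage_comp_const_mul (fun z => z ^ n * φ z) p 1
  rw [mul_one, hφ.circleAverage_zpow_mul n (norm_pos_iff.mpr hp0)] at h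
  rw [← h, ← smul_eq_mul, ← circleAverage_fun_smul]
  refine circleAverage_congr_sphere fun z hz => ?_
  have hz0 : z ≠ 0 := norm_pos_iff.mp (by simp [show ‖z‖ = 1 by simpa using hz])
  simp only [smul_eq_mul]
  rw [hφ.mul_left z hz0, mul_zpow, zpow_sub₀ hz0]
  norm_cast
  ring

open Real in
/-- A theta function of degree two is determined by two consecutive Laurent coefficients. -/
theorem eq_zero_of_circleAverage (hφ : IsThetaTwo p K φ) (hp0 : p ≠ 0) (hK : K ≠ 0)
    (h0 : circleAverage φ 0 1 = 0) (h1 : circleAverage (fun z => z * φ z) 0 1 = 0) {x : ℂ}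
    (hx : x ≠ 0) : φ x = 0 := by
  have hstep : ∀ n : ℤ, circleAverage (fun z => z ^ n * φ z) 0 1 = 0 ↔
      circleAverage (fun z => z ^ (n - 2) * φ z) 0 1 = 0 := fun n => by
    rw [hφ.circleAverage_rec hp0 n]
    simp [hK, zpow_ne_zero n hp0]
  have hpair : ∀ n : ℤ, circleAverage (fun z => z ^ n * φ z) 0 1 = 0 ∧
      circleAverage (fun z => z ^ (n + 1) * φ z) 0 1 = 0 := by
    intro n
    induction n using Int.induction_on with
    | zero => exact ⟨by simpa using h0, by simpa using h1⟩
    | succ n ih => exact ⟨ih.2, (hstep _).mpr (by convert ih.1 using 4; congr 1; ring)⟩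
    | pred n ih =>
      refine ⟨?_, by simpa using ih.1⟩
      have := (hstep _).mp ih.2
      convert this using 4
      congr 1
      ring
  refine eq_zero_of_circleAverage_zpow_mul (norm_pos_iff.mpr hx)
    (hφ.diff.continuousOn.mono fun z hz => ?_) (fun n => ?_) rfl
  · rintro rfl
    simp [eq_comm, hx] at hz
  · rw [hφ.circleAverage_zpow_mul n (norm_pos_iff.mpr hx)]
    exact (hpair n).1

open Real in
/-- Theta functions of degree two form a space of dimension at most two: if `ψ₁` and `ψ₂` separate
the points `x₁` and `x₂`, a third one that vanishes at both points is zero. -/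
theorem eq_zero_of_two_zeros (hp0 : p ≠ 0) (hK : K ≠ 0) {ψ₁ ψ₂ : ℂ → ℂ}
    (hφ : IsThetaTwo p K φ) (hψ₁ : IsThetaTwo p K ψ₁) (hψ₂ : IsThetaTwo p K ψ₂) {x₁ x₂ : ℂ}
    (hx₁ : x₁ ≠ 0) (hx₂ : x₂ ≠ 0) (h₁₁ : ψ₁ x₁ = 0) (h₁₂ : ψ₁ x₂ ≠ 0) (h₂₁ : ψ₂ x₁ ≠ 0)
    (h₂₂ : ψ₂ x₂ = 0) (hφ₁ : φ x₁ = 0) (hφ₂ : φ x₂ = 0) {x : ℂ} (hx : x ≠ 0) : φ x = 0 := by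
  have hint : ∀ {χ : ℂ → ℂ}, IsThetaTwo p K χ → ∀ n : ℕ,
      CircleIntegrable (fun z => z ^ n * χ z) 0 1 := fun {χ} hχ n =>
    ContinuousOn.circleIntegrable zero_le_one ((by fun_prop : ContinuousOn (fun z : ℂ => z ^ n) _).mul
      (hχ.diff.continuousOn.mono fun _ hz => by rintro rfl; simp at hz))
  have hlin : ∀ {χ₁ χ₂ : ℂ → ℂ}, IsThetaTwo p K χ₁ → IsThetaTwo p K χ₂ → ∀ a b : ℂ, ∀ n : ℕ,
      circleAverage (fun z => z ^ n * (a * χ₁ z + b * χ₂ z)) 0 1 =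
        a * circleAverage (fun z => z ^ n * χ₁ z) 0 1 +
        b * circleAverage (fun z => z ^ n * χ₂ z) 0 1 := fun {χ₁ χ₂} h₁ h₂ a b n => by
    rw [← smul_eq_mul a, ← smul_eq_mul b, ← circleAverage_fun_smul, ← circleAverage_fun_smul,
      ← circleAverage_fun_add (f₁ := fun z => a • (z ^ n * χ₁ z)) (f₂ := fun z => b • (z ^ n * χ₂ z))
        ((hint h₁ n).const_smul (a := a)) ((hint h₂ n).const_smul (a := b))]
    congr 1
    funext z
    simp only [smul_eq_mul]
    ring
  have hzero : ∀ {χ : ℂ → ℂ}, IsThetaTwo p K χ → circleAverage (fun z => z ^ 0 * χ z) 0 1 = 0 →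
      circleAverage (fun z => z ^ 1 * χ z) 0 1 = 0 → ∀ y, y ≠ 0 → χ y = 0 :=
    fun {χ} hχ h0 h1 y hy =>
      hχ.eq_zero_of_circleAverage hp0 hK (by simpa using h0) (by simpa using h1) hy
  set a₀ := circleAverage (fun z => z ^ 0 * φ z) 0 1 with ha₀
  set a₁ := circleAverage (fun z => z ^ 1 * φ z) 0 1 with ha₁
  set b₀ := circleAverage (fun z => z ^ 0 * ψ₁ z) 0 1 with hb₀
  set b₁ := circleAverage (fun z => z ^ 1 * ψ₁ z) 0 1 with hb₁
  set d₀ := circleAverage (fun z => z ^ 0 * ψ₂ z) 0 1 with hd₀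
  set d₁ := circleAverage (fun z => z ^ 1 * ψ₂ z) 0 1 with hd₁
  -- the coefficient vectors of `ψ₁` and `ψ₂` are independent, and Cramer's rule applies
  have hD : b₀ * d₁ - b₁ * d₀ ≠ 0 := by
    intro hD
    have key : ∀ α β : ℂ, α * b₀ + β * d₀ = 0 → α * b₁ + β * d₁ = 0 → α = 0 := by
      intro α β e0 e1
      have h := hzero ((hψ₁.const_mul α).add (hψ₂.const_mul β))
        (by rw [hlin hψ₁ hψ₂]; exact e0) (by rw [hlin hψ₁ hψ₂]; exact e1) x₂ hx₂
      simpa [h₂₂, h₁₂] using h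
    have hd1 : d₁ = 0 := key d₁ (-b₁) (by linear_combination hD) (by ring)
    have hd0 : d₀ = 0 := key d₀ (-b₀) (by ring) (by linear_combination -hD)
    exact h₂₁ (hzero hψ₂ hd0 hd1 x₁ hx₁)
  have hψ := (hψ₁.const_mul (-(a₀ * d₁ - a₁ * d₀))).add (hψ₂.const_mul (-(b₀ * a₁ - b₁ * a₀)))
  have h := hzero ((hφ.const_mul (b₀ * d₁ - b₁ * d₀)).add (hψ.const_mul 1))
    (by rw [hlin hφ hψ, hlin hψ₁ hψ₂]; ring) (by rw [hlin hφ hψ, hlin hψ₁ hψ₂]; ring)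
  have e₁ : b₀ * a₁ - b₁ * a₀ = 0 := by
    refine (mul_eq_zero.mp ?_).resolve_right h₂₁
    have := h x₁ hx₁
    rw [hφ₁, h₁₁] at this
    linear_combination -this
  have e₂ : a₀ * d₁ - a₁ * d₀ = 0 := by
    refine (mul_eq_zero.mp ?_).resolve_right h₁₂
    have := h x₂ hx₂
    rw [hφ₂, h₂₂] at this
    linear_combination -this
  have e := h x hx
  rw [e₁, e₂] at e
  simpa [hD] using e

end IsThetaTwo

theorem isThetaTwo_theta_mul_theta (hp : ‖p‖ < 1) (hp0 : p ≠ 0) {a C : ℂ} (ha : a ≠ 0) (hC : C ≠ 0) :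
    IsThetaTwo p (C * p⁻¹) fun x => theta p (a * x) * theta p (a * C * x⁻¹) := by
  refine ⟨fun x hx => ?_, fun x hx => ?_⟩
  · have hx' : x ≠ 0 := hx
    refine DifferentiableAt.differentiableWithinAt (DifferentiableAt.mul ?_ ?_)
    · exact DifferentiableAt.theta_comp hp (by fun_prop) (mul_ne_zero ha hx')
    · exact DifferentiableAt.theta_comp hp (by fun_prop (disch := assumption))
        (mul_ne_zero (mul_ne_zero ha hC) (inv_ne_zero hx'))
  · have h1 : theta p (a * (p * x)) = -(a * x)⁻¹ * theta p (a * x) := by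
      rw [mul_left_comm, theta_mul_self hp hp0 (mul_ne_zero ha hx)]
    have hy : a * C * (p * x)⁻¹ ≠ 0 :=
      mul_ne_zero (mul_ne_zero ha hC) (inv_ne_zero (mul_ne_zero hp0 hx))
    have h2 := theta_mul_self hp hp0 hy
    have h3 : p * (a * C * (p * x)⁻¹) = a * C * x⁻¹ := by field_simp
    rw [h3] at h2
    rw [h1, h2]
    field_simp

end Theta

/-! ### Theta function identities -/

section ThetaIdentities

variable {p : ℂ}

/-- The points excluded by genericity conditions `θ(c y; p) ≠ 0` are countable in number. -/
theorem countable_setOf_mul_eq_zpow (p : ℂ) {c : ℂ} (hc : c ≠ 0) :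
    {z : ℂ | ∃ k : ℤ, c * z = p ^ k}.Countable := by
  refine (Set.countable_range fun k : ℤ => c⁻¹ * p ^ k).mono ?_
  rintro z ⟨k, hk⟩
  exact ⟨k, by simp only [← hk]; field_simp⟩

/-- Variant of `isThetaTwo_theta_mul_theta` whose first factor has its zero at `x = a`. -/
theorem isThetaTwo_theta_mul_theta' (hp : ‖p‖ < 1) (hp0 : p ≠ 0) {a C : ℂ} (ha : a ≠ 0)
    (hC : C ≠ 0) : IsThetaTwo p (C * p⁻¹) fun x => theta p (x / a) * theta p (C / (a * x)) := by
  have h := isThetaTwo_theta_mul_theta hp hp0 (inv_ne_zero ha) hC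
  convert h using 3 with x
  · congr 1
    field_simp
  · congr 1
    field_simp

/-- The four-term identity off a countable set of `z`. As functions of `b`, with `b * d` fixed, the
three terms are theta functions of degree two with the same multiplier; the identity is evident at
`b = a⁻¹` and at `b = z`, and the genericity hypotheses make these two points separate the space. -/
theorem theta_four_term_of_generic (hp : ‖p‖ < 1) (hp0 : p ≠ 0) {a b c d z : ℂ} (ha : a ≠ 0)
    (hb : b ≠ 0) (hc : c ≠ 0) (hd : d ≠ 0) (hz : z ≠ 0) (h : a * b * c * d = p)
    (haz : theta p (a * z) ≠ 0) (hcz : theta p (c * z) ≠ 0) :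
    theta p (z ^ 2) * theta p (a * b) * theta p (a * c) * theta p (a * d) =
      theta p (a * z) * theta p (b * z) * theta p (c * z) * theta p (d * z) -
      z ^ 2 * (theta p (a / z) * theta p (b / z) * theta p (c / z) * theta p (d / z)) := by
  have hC : b * d ≠ 0 := mul_ne_zero hb hd
  -- the three terms as functions of `x = b`, with `d = C / x`
  have e₁ := isThetaTwo_theta_mul_theta hp hp0 ha hC
  have e₂ := isThetaTwo_theta_mul_theta hp hp0 hz hC
  have e₃ := isThetaTwo_theta_mul_theta' hp hp0 hz hC
  have hinv : ∀ {x y : ℂ}, x ≠ 0 → y ≠ 0 → theta p (y / x) = -(y / x) * theta p (x / y) :=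
    fun {x y} hx hy => by
      have := theta_inv hp (div_ne_zero hx hy)
      rwa [inv_div] at this
  have r₁ : theta p (a * (b * d) * z⁻¹) = theta p (c * z) := by
    rw [← theta_div_self hp0 (c * z), ← h]
    congr 1
    field_simp
  have r₂ : theta p (z * (b * d) * a) = theta p (c / z) := by
    rw [← theta_div_self hp0 (c / z), ← h]
    congr 1
    field_simp
  have r₃ : theta p (b * d) = theta p (a * c) := by
    rw [← theta_div_self hp0 (a * c), ← h]
    congr 1
    field_simp
  have r₄ : theta p (b * d / (z * a⁻¹)) = theta p (c * z) := by
    rw [← r₁]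
    congr 1
    field_simp
  have key := IsThetaTwo.eq_zero_of_two_zeros hp0 (mul_ne_zero hC (inv_ne_zero hp0))
    (((e₁.const_mul (theta p (z ^ 2) * theta p (a * c))).sub
      (e₂.const_mul (theta p (a * z) * theta p (c * z)))).add
      (e₃.const_mul (z ^ 2 * theta p (a / z) * theta p (c / z)))) e₁ e₃ (x₁ := a⁻¹) (x₂ := z)
    (inv_ne_zero ha) hz ?_ ?_ ?_ ?_ ?_ ?_ hb
  · have s₁ : a * (b * d) * b⁻¹ = a * d := by field_simp
    have s₂ : z * (b * d) * b⁻¹ = d * z := by field_simp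
    have s₃ : b * d / (z * b) = d / z := by field_simp
    simp only [s₁, s₂, s₃] at key
    rw [mul_comm z b] at key
    linear_combination key
  · simp only [mul_inv_cancel₀ ha, theta_one hp, zero_mul]
  · rw [r₁]
    exact mul_ne_zero haz hcz
  · rw [r₄]
    refine mul_ne_zero ?_ hcz
    have : a⁻¹ / z = (a * z)⁻¹ := by field_simp
    rw [this, theta_inv hp (mul_ne_zero ha hz)]
    exact mul_ne_zero (neg_ne_zero.mpr (inv_ne_zero (mul_ne_zero ha hz))) haz
  · simp only [div_self hz, theta_one hp, zero_mul]
  · have s₁ : a⁻¹ / z = (a * z)⁻¹ := by field_simp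
    have s₂ : z * a⁻¹ = z / a := by rw [div_eq_mul_inv]
    simp only [mul_inv_cancel₀ ha, theta_one hp, inv_inv, r₂, r₄, s₁,
      theta_inv hp (mul_ne_zero ha hz)]
    rw [s₂, hinv ha hz]
    field_simp
    ring
  · simp only [r₁, div_self hz, theta_one hp]
    have s₁ : z * (b * d) * z⁻¹ = b * d := by field_simp
    rw [s₁, r₃, pow_two]
    ring

/-- The addition formula for theta functions (Weierstrass), in the form with `a b c d = p`. -/
theorem theta_four_term (hp : ‖p‖ < 1) (hp0 : p ≠ 0) {a b c d z : ℂ} (ha : a ≠ 0)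
    (hb : b ≠ 0) (hc : c ≠ 0) (hd : d ≠ 0) (hz : z ≠ 0) (h : a * b * c * d = p) :
    theta p (z ^ 2) * theta p (a * b) * theta p (a * c) * theta p (a * d) =
      theta p (a * z) * theta p (b * z) * theta p (c * z) * theta p (d * z) -
      z ^ 2 * (theta p (a / z) * theta p (b / z) * theta p (c / z) * theta p (d / z)) := by
  refine eqOn_of_eq_off_countable (U := {0}ᶜ) isOpen_compl_singleton
    ((countable_setOf_mul_eq_zpow p ha).union (countable_setOf_mul_eq_zpow p hc))
    (f := fun z => theta p (z ^ 2) * theta p (a * b) * theta p (a * c) * theta p (a * d))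
    (g := fun z => theta p (a * z) * theta p (b * z) * theta p (c * z) * theta p (d * z) -
      z ^ 2 * (theta p (a / z) * theta p (b / z) * theta p (c / z) * theta p (d / z)))
    (fun x hx => ?_) (fun x hx => ?_) (fun x hx hS => ?_) hz
  · have hx : x ≠ 0 := hx
    exact (show DifferentiableAt ℂ _ x by
      fun_prop (disch := first | assumption | positivity)).continuousAt.continuousWithinAt
  · have hx : x ≠ 0 := hx
    exact (show DifferentiableAt ℂ _ x by
      fun_prop (disch := first | assumption | positivity)).continuousAt.continuousWithinAt
  · have hx : x ≠ 0 := hx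
    simp only [Set.mem_union, Set.mem_ofPred_eq, not_or, not_exists] at hS
    exact theta_four_term_of_generic hp hp0 ha hb hc hd hx h
      (theta_ne_zero hp hp0 (mul_ne_zero ha hx) hS.1) (theta_ne_zero hp hp0 (mul_ne_zero hc hx) hS.2)

/-- The six-parameter identity for generic parameters. As functions of `b`, with `b * e` fixed, all
four terms are theta functions of degree two with the same multiplier; at `b = s⁻¹` and at `b = a⁻¹`
the identity reduces to `theta_four_term`. -/
theorem theta_six_term_of_generic (hp : ‖p‖ < 1) (hp0 : p ≠ 0) {a s b c d e z : ℂ} (ha : a ≠ 0)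
    (hs : s ≠ 0) (hb : b ≠ 0) (hc : c ≠ 0) (hd : d ≠ 0) (he : e ≠ 0) (hz : z ≠ 0)
    (h : a * s * b * c * d * e = p) (hsa : theta p (s / a) ≠ 0) (hcd : theta p (c * d) ≠ 0) :
    z * theta p (z ^ 2) *
      (theta p (a * z) * theta p (a / z) *
        (theta p (s * b) * theta p (s * c) * theta p (s * d) * theta p (s * e)) -
       theta p (s * z) * theta p (s / z) *
        (theta p (a * b) * theta p (a * c) * theta p (a * d) * theta p (a * e))) =
    -a * theta p (s / a) *
      (theta p (a * z) * theta p (s * z) * theta p (b * z) * theta p (c * z) * theta p (d * z) *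
          theta p (e * z) -
        z ^ 4 * (theta p (a / z) * theta p (s / z) * theta p (b / z) * theta p (c / z) *
          theta p (d / z) * theta p (e / z))) := by
  have hC : b * e ≠ 0 := mul_ne_zero hb he
  -- the four terms as functions of `x = b`, with `e = C / x`
  have e₁ := isThetaTwo_theta_mul_theta hp hp0 hs hC
  have e₂ := isThetaTwo_theta_mul_theta hp hp0 ha hC
  have e₃ := isThetaTwo_theta_mul_theta hp hp0 hz hC
  have e₄ := isThetaTwo_theta_mul_theta' hp hp0 hz hC
  have hinv : ∀ {x y : ℂ}, x ≠ 0 → y ≠ 0 → theta p (y * x⁻¹) = -(y / x) * theta p (x / y) :=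
    fun {x y} hx hy => by
      have := theta_inv hp (div_ne_zero hx hy)
      rwa [inv_div, div_eq_mul_inv y x] at this
  have hinv' : ∀ {x y : ℂ}, x ≠ 0 → y ≠ 0 → theta p (x⁻¹ / y) = -(x * y)⁻¹ * theta p (x * y) :=
    fun {x y} hx hy => by
      rw [← theta_inv hp (mul_ne_zero hx hy)]
      congr 1
      field_simp
  have f₁ := theta_four_term hp hp0 ha hc hd (mul_ne_zero hs hC) hz
    (show a * c * d * (s * (b * e)) = p by rw [← h]; ring)
  have f₂ := theta_four_term hp hp0 hs hc hd (mul_ne_zero ha hC) hz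
    (show s * c * d * (a * (b * e)) = p by rw [← h]; ring)
  have r₁ : theta p (s * (b * e) * a) = theta p (c * d) := by
    rw [← theta_div_self hp0 (c * d), ← h]
    congr 1
    field_simp
  have r₂ : theta p (a * (b * e) * s) = theta p (c * d) := by
    rw [← r₁]
    congr 1
    ring
  have key := IsThetaTwo.eq_zero_of_two_zeros hp0 (mul_ne_zero hC (inv_ne_zero hp0))
    (((e₁.const_mul (z * theta p (z ^ 2) * (theta p (a * z) * theta p (a / z) *
          (theta p (s * c) * theta p (s * d))))).sub
      (e₂.const_mul (z * theta p (z ^ 2) * (theta p (s * z) * theta p (s / z) *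
          (theta p (a * c) * theta p (a * d)))))).add
      ((e₃.const_mul (a * theta p (s / a) *
          (theta p (a * z) * theta p (s * z) * theta p (c * z) * theta p (d * z)))).sub
        (e₄.const_mul (a * theta p (s / a) * (z ^ 4 *
          (theta p (a / z) * theta p (s / z) * theta p (c / z) * theta p (d / z)))))))
    e₁ e₂ (x₁ := s⁻¹) (x₂ := a⁻¹) (inv_ne_zero hs) (inv_ne_zero ha) ?_ ?_ ?_ ?_ ?_ ?_ hb
  · have s₁ : s * (b * e) * b⁻¹ = s * e := by field_simp
    have s₂ : a * (b * e) * b⁻¹ = a * e := by field_simp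
    have s₃ : z * (b * e) * b⁻¹ = e * z := by field_simp
    have s₄ : b * e / (z * b) = e / z := by field_simp
    simp only [s₁, s₂, s₃, s₄] at key
    rw [mul_comm z b] at key
    linear_combination key
  · simp only [mul_inv_cancel₀ hs, theta_one hp, zero_mul]
  · rw [inv_inv, r₁, ← div_eq_mul_inv]
    exact mul_ne_zero hsa hcd
  · rw [inv_inv, r₂, hinv hs ha]
    exact mul_ne_zero (mul_ne_zero (neg_ne_zero.mpr (div_ne_zero ha hs)) hsa) hcd
  · simp only [mul_inv_cancel₀ ha, theta_one hp, zero_mul]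
  · have s₁ : z * (b * e) * s = s * (b * e) * z := by ring
    have s₂ : b * e / (z * s⁻¹) = s * (b * e) / z := by field_simp
    have s₃ : a * (b * e) * s = a * (s * (b * e)) := by ring
    simp only [mul_inv_cancel₀ hs, theta_one hp, inv_inv, s₁, s₂, s₃, hinv hs ha, hinv hs hz,
      hinv' hs hz]
    have hk : (a / s) * z * (theta p (s * z) * theta p (s / z) * theta p (s / a)) *
      (theta p (z ^ 2) * theta p (a * c) * theta p (a * d) * theta p (a * (s * (b * e))) -
      (theta p (a * z) * theta p (c * z) * theta p (d * z) * theta p (s * (b * e) * z) -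
      z ^ 2 * (theta p (a / z) * theta p (c / z) * theta p (d / z) * theta p (s * (b * e) / z)))) =
      0 := by rw [f₁]; ring
    refine Eq.trans ?_ hk
    field_simp
    ring
  · have s₁ : z * (b * e) * a = a * (b * e) * z := by ring
    have s₂ : b * e / (z * a⁻¹) = a * (b * e) / z := by field_simp
    have s₃ : s * (b * e) * a = s * (a * (b * e)) := by ring
    simp only [mul_inv_cancel₀ ha, theta_one hp, inv_inv, s₁, s₂, s₃, hinv ha hz,
      hinv' ha hz]
    rw [← div_eq_mul_inv s a]
    have hk : z * (theta p (a * z) * theta p (a / z) * theta p (s / a)) *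
      (theta p (z ^ 2) * theta p (s * c) * theta p (s * d) * theta p (s * (a * (b * e))) -
      (theta p (s * z) * theta p (c * z) * theta p (d * z) * theta p (a * (b * e) * z) -
      z ^ 2 * (theta p (s / z) * theta p (c / z) * theta p (d / z) * theta p (a * (b * e) / z)))) =
      0 := by rw [f₂]; ring
    refine Eq.trans ?_ hk
    field_simp
    ring

/-- The theta function identity behind the contiguous relation of the integral: the left side
becomes a combination of two integrands, the right side a `q`-difference. -/
theorem theta_six_term (hp : ‖p‖ < 1) (hp0 : p ≠ 0) {a s b c d e z : ℂ} (ha : a ≠ 0)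
    (hs : s ≠ 0) (hb : b ≠ 0) (hc : c ≠ 0) (hd : d ≠ 0) (he : e ≠ 0) (hz : z ≠ 0)
    (h : a * s * b * c * d * e = p) :
    z * theta p (z ^ 2) *
      (theta p (a * z) * theta p (a / z) *
        (theta p (s * b) * theta p (s * c) * theta p (s * d) * theta p (s * e)) -
       theta p (s * z) * theta p (s / z) *
        (theta p (a * b) * theta p (a * c) * theta p (a * d) * theta p (a * e))) =
    -a * theta p (s / a) *
      (theta p (a * z) * theta p (s * z) * theta p (b * z) * theta p (c * z) * theta p (d * z) *
          theta p (e * z) -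
        z ^ 4 * (theta p (a / z) * theta p (s / z) * theta p (b / z) * theta p (c / z) *
          theta p (d / z) * theta p (e / z))) := by
  -- move `s` and `c` away from the exceptional positions, compensating with `e`
  have key := eqOn_of_eq_off_countable (U := {0}ᶜ) isOpen_compl_singleton
    ((countable_setOf_mul_eq_zpow p (div_ne_zero hs ha)).union
      (countable_setOf_mul_eq_zpow p (mul_ne_zero hc hd)))
    (f := fun w => z * theta p (z ^ 2) *
      (theta p (a * z) * theta p (a / z) * (theta p (s * w * b) * theta p (s * w * (c * w)) *
          theta p (s * w * d) * theta p (s * w * (e / w ^ 2))) -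
       theta p (s * w * z) * theta p (s * w / z) * (theta p (a * b) * theta p (a * (c * w)) *
          theta p (a * d) * theta p (a * (e / w ^ 2)))))
    (g := fun w => -a * theta p (s * w / a) *
      (theta p (a * z) * theta p (s * w * z) * theta p (b * z) * theta p (c * w * z) *
          theta p (d * z) * theta p (e / w ^ 2 * z) -
        z ^ 4 * (theta p (a / z) * theta p (s * w / z) * theta p (b / z) * theta p (c * w / z) *
          theta p (d / z) * theta p (e / w ^ 2 / z))))
    (fun x hx => ?_) (fun x hx => ?_) (fun x hx hS => ?_) (one_ne_zero : (1 : ℂ) ∈ ({0} : Set ℂ)ᶜ)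
  · simpa using key
  · have hx : x ≠ 0 := hx
    exact (show DifferentiableAt ℂ _ x by
      fun_prop (disch := first | assumption | positivity)).continuousAt.continuousWithinAt
  · have hx : x ≠ 0 := hx
    exact (show DifferentiableAt ℂ _ x by
      fun_prop (disch := first | assumption | positivity)).continuousAt.continuousWithinAt
  · have hx : x ≠ 0 := hx
    simp only [Set.mem_union, Set.mem_ofPred_eq, not_or, not_exists] at hS
    refine theta_six_term_of_generic hp hp0 ha (mul_ne_zero hs hx) hb (mul_ne_zero hc hx) hd
      (div_ne_zero he (pow_ne_zero 2 hx)) hz ?_ (theta_ne_zero hp hp0 (by positivity) ?_)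
      (theta_ne_zero hp hp0 (by positivity) ?_)
    · rw [← h]
      field_simp
    · intro k hk
      exact hS.1 k (by rw [← hk]; ring)
    · intro k hk
      exact hS.2 k (by rw [← hk]; ring)

end ThetaIdentities

/-! ### The elliptic gamma function -/

section EllipticGamma

variable {p q : ℂ}

theorem ellipticGamma_ne_zero (hp : ‖p‖ < 1) (hq : ‖q‖ < 1) {x : ℂ} (hx : ‖x‖ < 1)
    (hx' : ‖p * q * x⁻¹‖ < 1) : ellipticGamma x p q ≠ 0 :=
  div_ne_zero (pqShifted_ne_zero_of_norm_lt_one hp hq hx')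
    (pqShifted_ne_zero_of_norm_lt_one hp hq hx)

/-- The first order difference equation `Γ(q x; p, q) = θ(x; p) Γ(x; p, q)`. -/
theorem ellipticGamma_mul_left (hp : ‖p‖ < 1) (hq0 : q ≠ 0) (hq : ‖q‖ < 1) {x : ℂ} (hx : ‖x‖ < 1) :
    ellipticGamma (q * x) p q = theta p x * ellipticGamma x p q := by
  have h1 : p * q * (q * x)⁻¹ = p * x⁻¹ := by
    rw [mul_inv]
    field_simp
  have h2 : q * (p * x⁻¹) = p * q * x⁻¹ := by ring
  rw [ellipticGamma, ellipticGamma, theta, h1, pqShifted_eq_qShifted_mul' (p * x⁻¹) hp hq, h2,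
    pqShifted_eq_qShifted_mul' x hp hq]
  have h3 := qShifted_ne_zero_of_norm_lt_one hp hx
  field_simp

theorem continuousOn_ellipticGamma_comp {X : Type*} [TopologicalSpace X] {f : X → ℂ} {s : Set X}
    (hp : ‖p‖ < 1) (hq : ‖q‖ < 1) (hf : ContinuousOn f s) (h0 : ∀ x ∈ s, f x ≠ 0)
    (h1 : ∀ x ∈ s, ‖f x‖ < 1) : ContinuousOn (fun x => ellipticGamma (f x) p q) s :=
  ((differentiable_pqShifted hp hq).continuous.comp_continuousOn
    (continuousOn_const.mul (hf.inv₀ h0))).div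
    ((differentiable_pqShifted hp hq).continuous.comp_continuousOn hf)
    fun x hx => pqShifted_ne_zero_of_norm_lt_one hp hq (h1 x hx)

theorem differentiableOn_ellipticGamma_comp {f : ℂ → ℂ} {s : Set ℂ}
    (hp : ‖p‖ < 1) (hq : ‖q‖ < 1) (hf : DifferentiableOn ℂ f s) (h0 : ∀ x ∈ s, f x ≠ 0)
    (h1 : ∀ x ∈ s, ‖f x‖ < 1) : DifferentiableOn ℂ (fun x => ellipticGamma (f x) p q) s :=
  ((differentiable_pqShifted hp hq).comp_differentiableOn
    ((hf.fun_inv h0).const_mul (p * q))).div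
    ((differentiable_pqShifted hp hq).comp_differentiableOn hf)
    fun x hx => pqShifted_ne_zero_of_norm_lt_one hp hq (h1 x hx)

/-! ### The integrand on the unit circle -/

/-- The integrand of the elliptic beta integral without the factor `1 / z`, the reciprocal of
`Γ(z^{±2}; p, q)` being written as the product `θ(z²; q) θ(z⁻²; p)`. -/
noncomputable def betaKernel (p q : ℂ) (t : Fin 6 → ℂ) (z : ℂ) : ℂ :=
  (∏ j, ellipticGamma (t j * z) p q * ellipticGamma (t j * z⁻¹) p q) *
    (theta q (z ^ 2) * theta p (z ^ 2)⁻¹)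

/-- The reciprocal of `Γ(y; p, q) Γ(y⁻¹; p, q)` is the product of theta functions
`θ(y; q) θ(y⁻¹; p)`. At the poles `y = 1` of the gamma functions both sides are `0`. -/
theorem inv_ellipticGamma_sq (hp : ‖p‖ < 1) (hq : ‖q‖ < 1) {y : ℂ}
    (hy : ‖y‖ = 1) : (ellipticGamma y p q * ellipticGamma y⁻¹ p q)⁻¹ =
      theta q y * theta p y⁻¹ := by
  have hpq : ∀ {w : ℂ}, ‖w‖ = 1 → pqShifted (p * q * w) p q ≠ 0 := fun {w} hw =>
    pqShifted_ne_zero_of_norm_lt_one hp hq (by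
      rw [norm_mul, norm_mul, hw, mul_one]
      exact mul_lt_one_of_nonneg_of_lt_one_left (norm_nonneg _) hp hq.le)
  have h1 : pqShifted y p q = qShifted y q * (qShifted (p * y) p * pqShifted (p * q * y) p q) := by
    rw [pqShifted_eq_qShifted_mul y hp hq, pqShifted_eq_qShifted_mul' (p * y) hp hq]
    ring_nf
  have h2 : pqShifted y⁻¹ p q =
      qShifted y⁻¹ p * (qShifted (q * y⁻¹) q * pqShifted (p * q * y⁻¹) p q) := by
    rw [pqShifted_eq_qShifted_mul' y⁻¹ hp hq, pqShifted_eq_qShifted_mul (q * y⁻¹) hp hq]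
    ring_nf
  have h3 := hpq hy
  have h4 := hpq (w := y⁻¹) (by rw [norm_inv, hy, inv_one])
  rw [ellipticGamma, ellipticGamma, inv_inv, mul_inv, inv_div, inv_div, h1, h2, theta, theta,
    inv_inv]
  generalize pqShifted (p * q * y) p q = A at h3
  generalize pqShifted (p * q * y⁻¹) p q = B at h4
  field_simp

theorem ellipticBetaIntegrand_eq (hp : ‖p‖ < 1) (hq : ‖q‖ < 1) (t : Fin 6 → ℂ) {z : ℂ}
    (hz : ‖z‖ = 1) : ellipticBetaIntegrand t p q z = z⁻¹ * betaKernel p q t z := by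
  rw [ellipticBetaIntegrand, betaKernel, ← inv_ellipticGamma_sq hp hq (by rw [norm_pow, hz, one_pow]),
    inv_pow, div_eq_mul_inv, div_eq_mul_inv, mul_comm]

/-- The parameters allowed in the elliptic beta integral. -/
structure IsAdmissible (p q : ℂ) (t : Fin 6 → ℂ) : Prop where
  norm_lt_one : ∀ j, ‖t j‖ < 1
  prod_eq : ∏ j, t j = p * q

theorem IsAdmissible.ne_zero {t : Fin 6 → ℂ} (ht : IsAdmissible p q t) (hp0 : p ≠ 0) (hq0 : q ≠ 0)
    (j : Fin 6) : t j ≠ 0 := fun h =>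
  mul_ne_zero hp0 hq0 (by rw [← ht.prod_eq]; exact Finset.prod_eq_zero (Finset.mem_univ j) h)

theorem IsAdmissible.comp_perm {t : Fin 6 → ℂ} (ht : IsAdmissible p q t) (σ : Equiv.Perm (Fin 6)) :
    IsAdmissible p q (t ∘ σ) :=
  ⟨fun j => ht.norm_lt_one (σ j), by rw [← ht.prod_eq]; exact Equiv.prod_comp σ t⟩

/-- The complementary product `p q / (t_j t_k)` of four parameters lies in the unit disc, so that
`Γ(t_j t_k; p, q)` does not vanish. -/
theorem IsAdmissible.norm_div_lt_one {t : Fin 6 → ℂ} (ht : IsAdmissible p q t) (hp0 : p ≠ 0)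
    (hq0 : q ≠ 0) {j k : Fin 6} (hjk : j ≠ k) : ‖p * q * (t j * t k)⁻¹‖ < 1 := by
  have hk : k ∈ Finset.univ.erase j := Finset.mem_erase.mpr ⟨hjk.symm, Finset.mem_univ k⟩
  have h1 : p * q * (t j * t k)⁻¹ = ∏ i ∈ (Finset.univ.erase j).erase k, t i := by
    rw [← ht.prod_eq, ← Finset.mul_prod_erase _ _ (Finset.mem_univ j),
      ← Finset.mul_prod_erase _ _ hk]
    have := ht.ne_zero hp0 hq0 j
    have := ht.ne_zero hp0 hq0 k
    field_simp
  rw [h1, norm_prod, ← Finset.prod_const_one (s := (Finset.univ.erase j).erase k)]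
  refine Finset.prod_lt_prod_of_nonempty (fun i _ => norm_pos_iff.mpr (ht.ne_zero hp0 hq0 i))
    (fun i _ => ht.norm_lt_one i) (Finset.card_pos.mp ?_)
  rw [Finset.card_erase_of_mem hk, Finset.card_erase_of_mem (Finset.mem_univ j), Finset.card_univ,
    Fintype.card_fin]
  norm_num

theorem IsAdmissible.norm_mul_lt_one {t : Fin 6 → ℂ} (ht : IsAdmissible p q t) (j k : Fin 6) :
    ‖t j * t k‖ < 1 := by
  rw [norm_mul]
  exact mul_lt_one_of_nonneg_of_lt_one_left (norm_nonneg _) (ht.norm_lt_one j) (ht.norm_lt_one k).le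

/-- The product `∏_{j < k} Γ(t_j t_k; p, q)`. -/
noncomputable def betaProduct (p q : ℂ) (t : Fin 6 → ℂ) : ℂ :=
  ∏ j, ∏ k ∈ Finset.Ioi j, ellipticGamma (t j * t k) p q

theorem IsAdmissible.betaProduct_ne_zero {t : Fin 6 → ℂ} (ht : IsAdmissible p q t) (hp0 : p ≠ 0)
    (hq0 : q ≠ 0) (hp : ‖p‖ < 1) (hq : ‖q‖ < 1) : betaProduct p q t ≠ 0 :=
  Finset.prod_ne_zero_iff.mpr fun j _ => Finset.prod_ne_zero_iff.mpr fun k hk =>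
    ellipticGamma_ne_zero hp hq (ht.norm_mul_lt_one j k)
      (ht.norm_div_lt_one hp0 hq0 (Finset.mem_Ioi.mp hk).ne)

theorem betaProduct_expand (t : Fin 6 → ℂ) : betaProduct p q t =
    (ellipticGamma (t 0 * t 1) p q * ellipticGamma (t 0 * t 2) p q * ellipticGamma (t 0 * t 3) p q *
      ellipticGamma (t 0 * t 4) p q * ellipticGamma (t 0 * t 5) p q) *
    (ellipticGamma (t 1 * t 2) p q * ellipticGamma (t 1 * t 3) p q * ellipticGamma (t 1 * t 4) p q *
      ellipticGamma (t 1 * t 5) p q) *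
    (ellipticGamma (t 2 * t 3) p q * ellipticGamma (t 2 * t 4) p q * ellipticGamma (t 2 * t 5) p q) *
    (ellipticGamma (t 3 * t 4) p q * ellipticGamma (t 3 * t 5) p q) *
    ellipticGamma (t 4 * t 5) p q := by
  rw [betaProduct, Fin.prod_univ_six, show Finset.Ioi (0 : Fin 6) = {1, 2, 3, 4, 5} by decide,
    show Finset.Ioi (1 : Fin 6) = {2, 3, 4, 5} by decide,
    show Finset.Ioi (2 : Fin 6) = {3, 4, 5} by decide, show Finset.Ioi (3 : Fin 6) = {4, 5} by decide,
    show Finset.Ioi (4 : Fin 6) = {5} by decide, show Finset.Ioi (5 : Fin 6) = ∅ by decide]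
  simp [mul_assoc]

open Real in
/-- The elliptic beta integral divided by its asserted value, up to a factor independent of `t`. -/
noncomputable def betaRatio (p q : ℂ) (t : Fin 6 → ℂ) : ℂ :=
  circleAverage (betaKernel p q t) 0 1 / betaProduct p q t

theorem betaKernel_comp_perm (t : Fin 6 → ℂ) (σ : Equiv.Perm (Fin 6)) :
    betaKernel p q (t ∘ σ) = betaKernel p q t := by
  funext z
  rw [betaKernel, betaKernel]
  congr 1
  exact Equiv.prod_comp σ fun j => ellipticGamma (t j * z) p q * ellipticGamma (t j * z⁻¹) p q

theorem betaRatio_comp_swap_one (t : Fin 6 → ℂ) {k : Fin 6} (hk : k ≠ 0) :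
    betaRatio p q (t ∘ Equiv.swap 1 k) = betaRatio p q t := by
  rw [betaRatio, betaRatio, betaKernel_comp_perm]
  congr 1
  have h0 : Equiv.swap 1 k 0 = 0 := Equiv.swap_apply_of_ne_of_ne (by decide) hk.symm
  rw [betaProduct_expand, betaProduct_expand]
  simp only [Function.comp_apply, h0, Equiv.swap_apply_left]
  fin_cases k
  · exact absurd rfl hk
  · simp
  all_goals
    simp [Equiv.swap_apply_def, -mul_eq_mul_right_iff, -mul_eq_mul_left_iff]
    ring_nf

/-! ### Dependence on the parameters -/

theorem continuousOn_betaKernel {X : Type*} [TopologicalSpace X] {τ : X → Fin 6 → ℂ} {S : Set X}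
    (hp : ‖p‖ < 1) (hq : ‖q‖ < 1) (hτ : ∀ j, ContinuousOn (fun x => τ x j) S)
    (h0 : ∀ x ∈ S, ∀ j, τ x j ≠ 0) (h1 : ∀ x ∈ S, ∀ j, ‖τ x j‖ < 1) :
    ContinuousOn (fun x : X × ℂ => betaKernel p q (τ x.1) x.2) (S ×ˢ Metric.sphere 0 1) := by
  have hz : ∀ x ∈ S ×ˢ Metric.sphere (0 : ℂ) 1, ‖x.2‖ = 1 := fun x hx => by simpa using hx.2
  have hz0 : ∀ x ∈ S ×ˢ Metric.sphere (0 : ℂ) 1, x.2 ≠ 0 := fun x hx =>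
    norm_pos_iff.mp (by rw [hz x hx]; exact one_pos)
  have hτ' : ∀ j, ContinuousOn (fun x : X × ℂ => τ x.1 j) (S ×ˢ Metric.sphere 0 1) := fun j =>
    (hτ j).comp continuousOn_fst fun x hx => hx.1
  have hinv : ContinuousOn (fun x : X × ℂ => x.2⁻¹) (S ×ˢ Metric.sphere 0 1) :=
    continuousOn_snd.inv₀ hz0
  have hsq : ContinuousOn (fun x : X × ℂ => (x.2 ^ 2)⁻¹) (S ×ˢ Metric.sphere 0 1) :=
    (continuousOn_snd.pow 2).inv₀ fun x hx => pow_ne_zero 2 (hz0 x hx)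
  refine ContinuousOn.mul (continuousOn_finsetProd _ fun j _ => ContinuousOn.mul ?_ ?_)
    (ContinuousOn.mul ?_ ?_)
  · exact continuousOn_ellipticGamma_comp hp hq ((hτ' j).mul continuousOn_snd)
      (fun x hx => mul_ne_zero (h0 _ hx.1 j) (hz0 x hx)) fun x hx => by
        rw [norm_mul, hz x hx, mul_one]; exact h1 _ hx.1 j
  · exact continuousOn_ellipticGamma_comp hp hq ((hτ' j).mul hinv)
      (fun x hx => mul_ne_zero (h0 _ hx.1 j) (inv_ne_zero (hz0 x hx))) fun x hx => by
        rw [norm_mul, norm_inv, hz x hx, inv_one, mul_one]; exact h1 _ hx.1 j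
  · exact (differentiableOn_theta hq).continuousOn.comp (continuousOn_snd.pow 2)
      fun x hx => pow_ne_zero 2 (hz0 x hx)
  · exact (differentiableOn_theta hp).continuousOn.comp hsq
      fun x hx => inv_ne_zero (pow_ne_zero 2 (hz0 x hx))

theorem differentiableOn_betaRatio {τ : ℂ → Fin 6 → ℂ} {U : Set ℂ} (hU : IsOpen U)
    (hp0 : p ≠ 0) (hq0 : q ≠ 0) (hp : ‖p‖ < 1) (hq : ‖q‖ < 1)
    (hτ : ∀ j, DifferentiableOn ℂ (fun s => τ s j) U) (h : ∀ s ∈ U, IsAdmissible p q (τ s)) :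
    DifferentiableOn ℂ (fun s => betaRatio p q (τ s)) U := by
  have h0 : ∀ s ∈ U, ∀ j, τ s j ≠ 0 := fun s hs => (h s hs).ne_zero hp0 hq0
  refine DifferentiableOn.div (differentiableOn_circleAverage hU
    (continuousOn_betaKernel hp hq (fun j => (hτ j).continuousOn) h0
      fun s hs => (h s hs).norm_lt_one) fun z hz => ?_)
    (DifferentiableOn.fun_finsetProd fun j _ => DifferentiableOn.fun_finsetProd fun k _ =>
      differentiableOn_ellipticGamma_comp hp hq ((hτ j).mul (hτ k))
        (fun s hs => mul_ne_zero (h0 s hs j) (h0 s hs k)) fun s hs => (h s hs).norm_mul_lt_one j k)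
    fun s hs => (h s hs).betaProduct_ne_zero hp0 hq0 hp hq
  have hz0 : z ≠ 0 := norm_pos_iff.mp (by rw [hz]; exact one_pos)
  refine DifferentiableOn.mul_const (DifferentiableOn.fun_finsetProd fun j _ => DifferentiableOn.mul
    (differentiableOn_ellipticGamma_comp hp hq ((hτ j).mul_const z)
      (fun s hs => mul_ne_zero (h0 s hs j) hz0) fun s hs => ?_)
    (differentiableOn_ellipticGamma_comp hp hq ((hτ j).mul_const z⁻¹)
      (fun s hs => mul_ne_zero (h0 s hs j) (inv_ne_zero hz0)) fun s hs => ?_)) _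
  · rw [norm_mul, hz, mul_one]; exact (h s hs).norm_lt_one j
  · rw [norm_mul, norm_inv, hz, inv_one, mul_one]; exact (h s hs).norm_lt_one j

theorem continuousOn_betaKernel_sphere {t : Fin 6 → ℂ} (hp : ‖p‖ < 1) (hq : ‖q‖ < 1)
    (h0 : ∀ j, t j ≠ 0) (h1 : ∀ j, ‖t j‖ < 1) :
    ContinuousOn (betaKernel p q t) (Metric.sphere 0 1) :=
  (continuousOn_betaKernel (X := Unit) (τ := fun _ => t) (S := Set.univ) hp hq
    (fun _ => continuousOn_const) (fun _ _ => h0) fun _ _ => h1).comp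
    (f := fun z : ℂ => ((), z)) (by fun_prop) fun z hz => ⟨Set.mem_univ _, hz⟩

end EllipticGamma

/-! ### The contiguous relation of the integral -/

section ShiftInvariance

variable {p q : ℂ}

open Real in
/-- If `h` is holomorphic on the annulus `|q| ≤ |z| ≤ 1`, then `h(q z) - h(z)` has mean zero. -/
theorem circleAverage_shift_eq {h : ℂ → ℂ} (hq0 : q ≠ 0) (hq : ‖q‖ ≤ 1) {U : Set ℂ}
    (hU : IsOpen U) (hsub : ∀ z : ℂ, ‖q‖ ≤ ‖z‖ → ‖z‖ ≤ 1 → z ∈ U) (hd : DifferentiableOn ℂ h U) :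
    circleAverage (fun z => h (q * z)) 0 1 = circleAverage h 0 1 := by
  rw [circleAverage_comp_const_mul, mul_one]
  refine (circleAverage_eq_of_annulus (norm_pos_iff.mpr hq0) hq
    (hd.continuousOn.mono fun z hz => hsub z hz.1 hz.2) fun z h1 h2 => ?_).symm
  exact hd.differentiableAt (hU.mem_nhds (hsub z h1.le h2.le))

/-- The function `h` that, up to a constant, has the combination of integrands in
`circleAverage_betaKernel_contiguous` as its `q`-difference `h(q z) - h(z)`. -/
noncomputable def betaPrimitive (p q : ℂ) (u : Fin 6 → ℂ) (z : ℂ) : ℂ :=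
  z * theta q (z ^ 2) * ∏ j, ellipticGamma (u j * z) p q * ellipticGamma (q * (u j * z⁻¹)) p q

theorem isOpen_betaPrimitive_domain (q : ℂ) (u : Fin 6 → ℂ) :
    IsOpen {z : ℂ | z ≠ 0 ∧ ∀ j, ‖u j * z‖ < 1 ∧ ‖q * u j‖ < ‖z‖} := by
  have h : IsOpen {z : ℂ | ∀ j, ‖u j * z‖ < 1 ∧ ‖q * u j‖ < ‖z‖} := by
    rw [Set.ofPred_forall]
    refine isOpen_iInter_of_finite fun j => ?_
    have h₁ : IsOpen {z : ℂ | ‖u j * z‖ < 1} := isOpen_lt (by fun_prop) continuous_const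
    have h₂ : IsOpen {z : ℂ | ‖q * u j‖ < ‖z‖} := isOpen_lt continuous_const continuous_norm
    exact h₁.inter h₂
  exact isOpen_ne.inter h

/-- The domain of holomorphy of `betaPrimitive` contains the closed annulus `|q| ≤ |z| ≤ 1`. -/
theorem mem_betaPrimitive_domain (hq0 : q ≠ 0) {u : Fin 6 → ℂ} (hu : ∀ j, ‖u j‖ < 1) {z : ℂ}
    (h1 : ‖q‖ ≤ ‖z‖) (h2 : ‖z‖ ≤ 1) : z ≠ 0 ∧ ∀ j, ‖u j * z‖ < 1 ∧ ‖q * u j‖ < ‖z‖ := by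
  have hqn : 0 < ‖q‖ := norm_pos_iff.mpr hq0
  refine ⟨norm_pos_iff.mp (hqn.trans_le h1), fun j => ⟨?_, ?_⟩⟩
  · rw [norm_mul]
    exact mul_lt_one_of_nonneg_of_lt_one_left (norm_nonneg _) (hu j) h2
  · refine lt_of_lt_of_le ?_ h1
    rw [norm_mul]
    exact mul_lt_of_lt_one_right hqn (hu j)

theorem differentiableOn_betaPrimitive (hp : ‖p‖ < 1) (hq0 : q ≠ 0) (hq : ‖q‖ < 1)
    {u : Fin 6 → ℂ} (hu0 : ∀ j, u j ≠ 0) : DifferentiableOn ℂ (betaPrimitive p q u)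
      {z : ℂ | z ≠ 0 ∧ ∀ j, ‖u j * z‖ < 1 ∧ ‖q * u j‖ < ‖z‖} := by
  refine DifferentiableOn.mul (differentiableOn_id.mul
    ((differentiableOn_theta hq).comp (by fun_prop) fun z hz => pow_ne_zero 2 hz.1))
    (DifferentiableOn.fun_finsetProd fun j _ => DifferentiableOn.mul
      (differentiableOn_ellipticGamma_comp hp hq (by fun_prop)
        (fun z hz => mul_ne_zero (hu0 j) hz.1) fun z hz => (hz.2 j).1)
      (differentiableOn_ellipticGamma_comp hp hq
        (((differentiableOn_id.fun_inv fun z hz => hz.1).const_mul (u j)).const_mul q)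
        (fun z hz => mul_ne_zero hq0 (mul_ne_zero (hu0 j) (inv_ne_zero hz.1))) fun z hz => ?_))
  have hz' := (hz.2 j).2
  rwa [← mul_assoc, norm_mul, norm_inv, ← div_eq_mul_inv, div_lt_one (norm_pos_iff.mpr hz.1)]

open Real in
/-- The contiguous relation: multiplying one of two parameters by `q` instead of the other changes
the integral by an explicit quotient of theta functions. A combination of the two integrands
equals `h(q z) - h(z)` with `h` a multiple of `betaPrimitive`, and this has mean zero. -/
theorem circleAverage_betaKernel_contiguous (hp0 : p ≠ 0) (hp : ‖p‖ < 1) (hq0 : q ≠ 0)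
    (hq : ‖q‖ < 1) {s a b c d e : ℂ} (h0 : ∀ j, (![s, a, b, c, d, e] : Fin 6 → ℂ) j ≠ 0)
    (h1 : ∀ j, ‖(![s, a, b, c, d, e] : Fin 6 → ℂ) j‖ < 1) (hprod : a * s * b * c * d * e = p) :
    circleAverage (betaKernel p q ![s, q * a, b, c, d, e]) 0 1 *
        (theta p (s * b) * theta p (s * c) * theta p (s * d) * theta p (s * e)) =
      circleAverage (betaKernel p q ![q * s, a, b, c, d, e]) 0 1 *
        (theta p (a * b) * theta p (a * c) * theta p (a * d) * theta p (a * e)) := by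
  have hs0 : s ≠ 0 := h0 0
  have ha0 : a ≠ 0 := h0 1
  have hb0 : b ≠ 0 := h0 2
  have hc0 : c ≠ 0 := h0 3
  have hd0 : d ≠ 0 := h0 4
  have he0 : e ≠ 0 := h0 5
  have hs1 : ‖s‖ < 1 := h1 0
  have ha1 : ‖a‖ < 1 := h1 1
  have hqlt : ∀ {x : ℂ}, ‖x‖ < 1 → ‖q * x‖ < 1 := fun {x} hx => by
    rw [norm_mul]
    exact mul_lt_one_of_nonneg_of_lt_one_left (norm_nonneg _) hq hx.le
  have hci : ∀ {t : Fin 6 → ℂ}, (∀ j, t j ≠ 0) → (∀ j, ‖t j‖ < 1) →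
      CircleIntegrable (betaKernel p q t) 0 1 := fun {t} h0 h1 =>
    (continuousOn_betaKernel_sphere hp hq h0 h1).circleIntegrable zero_le_one
  have hci₁ : CircleIntegrable (betaKernel p q ![s, q * a, b, c, d, e]) 0 1 := by
    refine hci (fun j => ?_) (fun j => ?_) <;> fin_cases j
    exacts [h0 0, mul_ne_zero hq0 (h0 1), h0 2, h0 3, h0 4, h0 5, h1 0, hqlt (h1 1), h1 2, h1 3,
      h1 4, h1 5]
  have hci₂ : CircleIntegrable (betaKernel p q ![q * s, a, b, c, d, e]) 0 1 := by
    refine hci (fun j => ?_) (fun j => ?_) <;> fin_cases j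
    exacts [mul_ne_zero hq0 (h0 0), h0 1, h0 2, h0 3, h0 4, h0 5, hqlt (h1 0), h1 1, h1 2, h1 3,
      h1 4, h1 5]
  have hhol := differentiableOn_betaPrimitive hp hq0 hq h0
  have hshift := circleAverage_shift_eq hq0 hq.le (isOpen_betaPrimitive_domain q _)
    (fun z => mem_betaPrimitive_domain hq0 h1) hhol
  have hcp₁ : CircleIntegrable (betaPrimitive p q ![s, a, b, c, d, e]) 0 1 :=
    ContinuousOn.circleIntegrable zero_le_one (hhol.continuousOn.mono fun z hz => by
      have hz1 : ‖z‖ = 1 := by simpa using hz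
      exact mem_betaPrimitive_domain hq0 h1 (hz1 ▸ hq.le) hz1.le)
  have hcp₂ : CircleIntegrable (fun z => betaPrimitive p q ![s, a, b, c, d, e] (q * z)) 0 1 :=
    ContinuousOn.circleIntegrable zero_le_one (hhol.continuousOn.comp (by fun_prop) fun z hz => by
      have hz1 : ‖q * z‖ = ‖q‖ := by
        rw [norm_mul, show ‖z‖ = 1 by simpa using hz, mul_one]
      exact mem_betaPrimitive_domain hq0 h1 hz1.ge (hz1 ▸ hq.le))
  set Θs := theta p (s * b) * theta p (s * c) * theta p (s * d) * theta p (s * e) with hΘs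
  set Θa := theta p (a * b) * theta p (a * c) * theta p (a * d) * theta p (a * e) with hΘa
  have hpoint : ∀ z ∈ Metric.sphere (0 : ℂ) |1|,
      Θs * betaKernel p q ![s, q * a, b, c, d, e] z + a * theta p (s / a) *
        betaPrimitive p q ![s, a, b, c, d, e] z =
      Θa * betaKernel p q ![q * s, a, b, c, d, e] z + a * theta p (s / a) *
        betaPrimitive p q ![s, a, b, c, d, e] (q * z) := by
    intro z hz
    have hz1 : ‖z‖ = 1 := by simpa using hz
    have hz0 : z ≠ 0 := norm_pos_iff.mp (by rw [hz1]; exact one_pos)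
    have hG : ∀ x : ℂ, ‖x‖ < 1 →
        ellipticGamma (q * (x * z)) p q = theta p (x * z) * ellipticGamma (x * z) p q ∧
        ellipticGamma (q * (x * z⁻¹)) p q = theta p (x / z) * ellipticGamma (x * z⁻¹) p q := by
      intro x hx
      refine ⟨ellipticGamma_mul_left hp hq0 hq (by rw [norm_mul, hz1, mul_one]; exact hx), ?_⟩
      rw [div_eq_mul_inv]
      exact ellipticGamma_mul_left hp hq0 hq (by rw [norm_mul, norm_inv, hz1, inv_one, mul_one]; exact hx)
    have hGs := hG s hs1
    have hGa := hG a ha1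
    have hGb := hG b (h1 2)
    have hGc := hG c (h1 3)
    have hGd := hG d (h1 4)
    have hGe := hG e (h1 5)
    have hcancel : ∀ x : ℂ, q * (x * (q * z)⁻¹) = x * z⁻¹ := fun x => by field_simp
    have hcomm : ∀ x : ℂ, x * (q * z) = q * (x * z) := fun x => by ring
    have hθq : theta q ((q * z) ^ 2) = (q * z ^ 4)⁻¹ * theta q (z ^ 2) := by
      have e1 : (q * z) ^ 2 = q * (q * z ^ 2) := by ring
      rw [e1, theta_mul_self hq hq0 (mul_ne_zero hq0 (pow_ne_zero 2 hz0)),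
        theta_mul_self hq hq0 (pow_ne_zero 2 hz0)]
      field_simp
    have hθp : theta p (z ^ 2)⁻¹ = -(z ^ 2)⁻¹ * theta p (z ^ 2) := theta_inv hp (pow_ne_zero 2 hz0)
    have hsix := theta_six_term hp hp0 ha0 hs0 hb0 hc0 hd0 he0 hz0 hprod
    rw [← hΘs, ← hΘa] at hsix
    simp only [betaKernel, betaPrimitive, Fin.prod_univ_six, Matrix.cons_val, hcancel, hcomm, hθq,
      hθp, mul_assoc q s, mul_assoc q a, hGs.1, hGs.2, hGa.1, hGa.2, hGb.1, hGb.2, hGc.1, hGc.2,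
      hGd.1, hGd.2, hGe.1, hGe.2]
    linear_combination (norm := (field_simp; ring)) (-(z ^ 3)⁻¹ * theta q (z ^ 2) *
      (ellipticGamma (s * z) p q * ellipticGamma (s * z⁻¹) p q *
      (ellipticGamma (a * z) p q * ellipticGamma (a * z⁻¹) p q) *
      (ellipticGamma (b * z) p q * ellipticGamma (b * z⁻¹) p q) *
      (ellipticGamma (c * z) p q * ellipticGamma (c * z⁻¹) p q) *
      (ellipticGamma (d * z) p q * ellipticGamma (d * z⁻¹) p q) *
      (ellipticGamma (e * z) p q * ellipticGamma (e * z⁻¹) p q))) * hsix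
  have hsplit : ∀ {f g : ℂ → ℂ} (α β : ℂ), CircleIntegrable f 0 1 → CircleIntegrable g 0 1 →
      circleAverage (fun z => α * f z + β * g z) 0 1 =
        α * circleAverage f 0 1 + β * circleAverage g 0 1 := fun {f g} α β hf hg => by
    rw [← smul_eq_mul α, ← smul_eq_mul β, ← circleAverage_fun_smul, ← circleAverage_fun_smul,
      ← circleAverage_fun_add (f₁ := fun z => α • f z) (f₂ := fun z => β • g z)
        (hf.const_smul (a := α)) (hg.const_smul (a := β))]
    simp only [smul_eq_mul]
  have key := circleAverage_congr_sphere hpoint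
  rw [hsplit _ _ hci₁ hcp₁, hsplit _ _ hci₂ hcp₂, hshift] at key
  linear_combination key

end ShiftInvariance

/-! ### Constancy of the ratio -/

section Constancy

variable {p q : ℂ}

/-- The product of gamma functions satisfies the contiguous relation of the integral, so that the
ratio does not notice which of two parameters carries the factor `q`. -/
theorem betaRatio_contiguous (hp0 : p ≠ 0) (hp : ‖p‖ < 1) (hq0 : q ≠ 0)
    (hq : ‖q‖ < 1) {s a b c d e : ℂ} (h0 : ∀ j, (![s, a, b, c, d, e] : Fin 6 → ℂ) j ≠ 0)
    (h1 : ∀ j, ‖(![s, a, b, c, d, e] : Fin 6 → ℂ) j‖ < 1) (hprod : a * s * b * c * d * e = p) :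
    betaRatio p q ![s, q * a, b, c, d, e] = betaRatio p q ![q * s, a, b, c, d, e] := by
  have hqlt : ∀ {x : ℂ}, ‖x‖ < 1 → ‖q * x‖ < 1 := fun {x} hx => by
    rw [norm_mul]
    exact mul_lt_one_of_nonneg_of_lt_one_left (norm_nonneg _) hq hx.le
  have hA₁ : IsAdmissible p q ![s, q * a, b, c, d, e] := by
    refine ⟨fun j => ?_, ?_⟩
    · fin_cases j
      exacts [h1 0, hqlt (h1 1), h1 2, h1 3, h1 4, h1 5]
    · rw [← hprod, Fin.prod_univ_six]
      simp only [Matrix.cons_val]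
      ring
  have hA₂ : IsAdmissible p q ![q * s, a, b, c, d, e] := by
    refine ⟨fun j => ?_, ?_⟩
    · fin_cases j
      exacts [hqlt (h1 0), h1 1, h1 2, h1 3, h1 4, h1 5]
    · rw [← hprod, Fin.prod_univ_six]
      simp only [Matrix.cons_val]
      ring
  have key := circleAverage_betaKernel_contiguous hp0 hp hq0 hq h0 h1 hprod
  -- the theta factors of the contiguous relation turn `Γ(x y)` into `Γ(q x y)`
  have hG : ∀ j k, ellipticGamma (q * ((![s, a, b, c, d, e] : Fin 6 → ℂ) j *
      (![s, a, b, c, d, e] : Fin 6 → ℂ) k)) p q =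
      theta p ((![s, a, b, c, d, e] : Fin 6 → ℂ) j * (![s, a, b, c, d, e] : Fin 6 → ℂ) k) *
      ellipticGamma ((![s, a, b, c, d, e] : Fin 6 → ℂ) j * (![s, a, b, c, d, e] : Fin 6 → ℂ) k) p q :=
    fun j k => ellipticGamma_mul_left hp hq0 hq (by
      rw [norm_mul]
      exact mul_lt_one_of_nonneg_of_lt_one_left (norm_nonneg _) (h1 j) (h1 k).le)
  have g₁ := hG 0 2
  have g₂ := hG 0 3
  have g₃ := hG 0 4
  have g₄ := hG 0 5
  have g₅ := hG 1 2
  have g₆ := hG 1 3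
  have g₇ := hG 1 4
  have g₈ := hG 1 5
  simp only [Matrix.cons_val] at g₁ g₂ g₃ g₄ g₅ g₆ g₇ g₈
  rw [betaRatio, betaRatio, div_eq_div_iff (hA₁.betaProduct_ne_zero hp0 hq0 hp hq)
    (hA₂.betaProduct_ne_zero hp0 hq0 hp hq), betaProduct_expand, betaProduct_expand]
  simp only [Matrix.cons_val, mul_assoc q, mul_left_comm s q a, g₁, g₂, g₃, g₄, g₅, g₆, g₇, g₈]
  linear_combination (ellipticGamma (q * (s * a)) p q *
    (ellipticGamma (s * b) p q * ellipticGamma (s * c) p q * ellipticGamma (s * d) p q *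
      ellipticGamma (s * e) p q) *
    (ellipticGamma (a * b) p q * ellipticGamma (a * c) p q * ellipticGamma (a * d) p q *
      ellipticGamma (a * e) p q) *
    (ellipticGamma (b * c) p q * ellipticGamma (b * d) p q * ellipticGamma (b * e) p q) *
    (ellipticGamma (c * d) p q * ellipticGamma (c * e) p q) * ellipticGamma (d * e) p q) * key

/-- With four parameters and the product `B` of the other two fixed, the ratio is a function of one
variable on the annulus `‖B‖ < ‖x‖ < 1`; the contiguous relation makes it invariant under `x ↦ q x`,
hence constant. -/
theorem betaRatio_pair (hp0 : p ≠ 0) (hp : ‖p‖ < 1) (hq0 : q ≠ 0) (hq : ‖q‖ < 1)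
    {B b c d e : ℂ} (hb : ‖b‖ < 1) (hc : ‖c‖ < 1) (hd : ‖d‖ < 1) (he : ‖e‖ < 1)
    (hprod : B * b * c * d * e = p * q) {x y : ℂ} (hx : ‖B‖ < ‖q * x‖) (hx' : ‖x‖ < 1)
    (hy : ‖B‖ < ‖q * y‖) (hy' : ‖y‖ < 1) :
    betaRatio p q ![B * x⁻¹, x, b, c, d, e] = betaRatio p q ![B * y⁻¹, y, b, c, d, e] := by
  have hpq : B * b * c * d * e ≠ 0 := by rw [hprod]; exact mul_ne_zero hp0 hq0
  have he0 : e ≠ 0 := right_ne_zero_of_mul hpq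
  have hd0 : d ≠ 0 := right_ne_zero_of_mul (left_ne_zero_of_mul hpq)
  have hc0 : c ≠ 0 := right_ne_zero_of_mul (left_ne_zero_of_mul (left_ne_zero_of_mul hpq))
  have hBb := left_ne_zero_of_mul (left_ne_zero_of_mul (left_ne_zero_of_mul hpq))
  have hb0 : b ≠ 0 := right_ne_zero_of_mul hBb
  have hB0 : B ≠ 0 := left_ne_zero_of_mul hBb
  have hne : ∀ {z : ℂ}, ‖B‖ < ‖z‖ → z ≠ 0 := fun hz => norm_pos_iff.mp ((norm_nonneg _).trans_lt hz)
  have hlt : ∀ {z : ℂ}, ‖B‖ < ‖z‖ → ‖B * z⁻¹‖ < 1 := fun {z} hz => by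
    rw [norm_mul, norm_inv, ← div_eq_mul_inv, div_lt_one ((norm_nonneg _).trans_lt hz)]
    exact hz
  refine eq_of_mul_invariant_on_annulus (f := fun z => betaRatio p q ![B * z⁻¹, z, b, c, d, e])
    hq (norm_nonneg B) ?_ ?_ hx hx' hy hy'
  · refine differentiableOn_betaRatio ((isOpen_lt continuous_const continuous_norm).inter
      (isOpen_lt continuous_norm continuous_const)) hp0 hq0 hp hq (fun j => ?_) fun z hz => ⟨fun j => ?_, ?_⟩
    · have h1 : DifferentiableOn ℂ (fun z => B * z⁻¹) {z | ‖B‖ < ‖z‖ ∧ ‖z‖ < 1} :=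
        (differentiableOn_id.fun_inv fun z hz => hne hz.1).const_mul B
      fin_cases j
      exacts [h1, differentiableOn_id, differentiableOn_const _, differentiableOn_const _,
        differentiableOn_const _, differentiableOn_const _]
    · fin_cases j
      exacts [hlt hz.1, hz.2, hb, hc, hd, he]
    · have hz0 := hne hz.1
      rw [Fin.prod_univ_six, ← hprod]
      simp only [Matrix.cons_val]
      field_simp
  · intro z hz hz'
    have hz0 : z ≠ 0 := right_ne_zero_of_mul (hne hz)
    have hs : ‖B * (q * z)⁻¹‖ < 1 := hlt hz
    have key := betaRatio_contiguous (s := B * (q * z)⁻¹) (a := z) (b := b) (c := c) (d := d)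
      (e := e) hp0 hp hq0 hq (fun j => ?_) (fun j => ?_) ?_
    · rw [show q * (B * (q * z)⁻¹) = B * z⁻¹ by field_simp] at key
      exact key
    · fin_cases j
      exacts [mul_ne_zero hB0 (inv_ne_zero (mul_ne_zero hq0 hz0)), hz0, hb0, hc0, hd0, he0]
    · fin_cases j
      exacts [hs, hz', hb, hc, hd, he]
    · have : p = B * b * c * d * e / q := by rw [hprod]; field_simp
      rw [this]
      field_simp

/-- The ratio agrees at two admissible points that differ only in the entries `0` and `k`, if the
entries `0` are smaller than `q`. That is the condition for `betaRatio_pair`: with `B = t 0 * t k`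
it says `‖B‖ < ‖q * t k‖`. -/
theorem betaRatio_eq_of_agree (hp0 : p ≠ 0) (hp : ‖p‖ < 1) (hq0 : q ≠ 0) (hq : ‖q‖ < 1)
    {t u : Fin 6 → ℂ} (ht : IsAdmissible p q t) (hu : IsAdmissible p q u) {k : Fin 6} (hk : k ≠ 0)
    (h : ∀ j, j ≠ 0 → j ≠ k → t j = u j) (ht0 : ‖t 0‖ < ‖q‖) (hu0 : ‖u 0‖ < ‖q‖) :
    betaRatio p q t = betaRatio p q u := by
  wlog hk1 : k = 1 generalizing t u k
  · rw [← betaRatio_comp_swap_one t hk, ← betaRatio_comp_swap_one u hk]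
    have h0 : Equiv.swap 1 k 0 = 0 := Equiv.swap_apply_of_ne_of_ne (by decide) hk.symm
    refine this (ht.comp_perm _) (hu.comp_perm _) (k := 1) (by decide) (fun j hj0 hj1 => ?_) ?_ ?_ rfl
    · refine h _ (fun h' => hj0 ?_) fun h' => hj1 ?_
      · rw [← h0] at h'
        exact (Equiv.swap 1 k).injective h'
      · rw [← Equiv.swap_apply_left 1 k] at h'
        exact (Equiv.swap 1 k).injective h'
    · simpa [h0] using ht0
    · simpa [h0] using hu0
  subst hk1
  have e2 := h 2 (by decide) (by decide)
  have e3 := h 3 (by decide) (by decide)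
  have e4 := h 4 (by decide) (by decide)
  have e5 := h 5 (by decide) (by decide)
  have hprod := ht.prod_eq
  have hprod' := hu.prod_eq
  rw [Fin.prod_univ_six] at hprod hprod'
  have t1 := ht.ne_zero hp0 hq0 1
  have u1 := hu.ne_zero hp0 hq0 1
  have hB : u 0 * u 1 = t 0 * t 1 := by
    have hne : t 2 * t 3 * t 4 * t 5 ≠ 0 := mul_ne_zero (mul_ne_zero (mul_ne_zero
      (ht.ne_zero hp0 hq0 2) (ht.ne_zero hp0 hq0 3)) (ht.ne_zero hp0 hq0 4)) (ht.ne_zero hp0 hq0 5)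
    refine mul_right_cancel₀ hne ?_
    rw [← e2, ← e3, ← e4, ← e5] at hprod'
    linear_combination hprod' - hprod
  have key := betaRatio_pair (B := t 0 * t 1) hp0 hp hq0 hq (ht.norm_lt_one 2) (ht.norm_lt_one 3)
    (ht.norm_lt_one 4) (ht.norm_lt_one 5) hprod (x := t 1) (y := u 1) ?_ (ht.norm_lt_one 1) ?_
    (hu.norm_lt_one 1)
  · rw [show t = ![t 0 * t 1 * (t 1)⁻¹, t 1, t 2, t 3, t 4, t 5] from ?_, key]
    · congr 1
      funext j
      fin_cases j
      · simp only [Fin.zero_eta, Matrix.cons_val_zero, ← hB]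
        field_simp
      exacts [rfl, e2, e3, e4, e5]
    · funext j
      fin_cases j
      · simp only [Fin.zero_eta, Matrix.cons_val_zero]
        field_simp
      all_goals rfl
  · rw [norm_mul, norm_mul]
    exact mul_lt_mul_of_pos_right ht0 (norm_pos_iff.mpr t1)
  · rw [← hB, norm_mul, norm_mul]
    exact mul_lt_mul_of_pos_right hu0 (norm_pos_iff.mpr u1)

/-- If five parameters are larger than `r`, where `‖p‖ ≤ r ^ 5`, the sixth one determined by them is
smaller than `q`. -/
theorem isAdmissible_cons (hq : ‖q‖ < 1) {r : ℝ} (hr : 0 < r)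
    (hpr : ‖p‖ ≤ r ^ 5) {x : Fin 5 → ℂ} (hx : ∀ j, r < ‖x j‖) (hx1 : ∀ j, ‖x j‖ < 1)
    (hq0 : q ≠ 0) :
    IsAdmissible p q (Fin.cons (p * q * (∏ j, x j)⁻¹) x) ∧ ‖p * q * (∏ j, x j)⁻¹‖ < ‖q‖ := by
  have hr5 : r ^ 5 < ∏ j, ‖x j‖ := by
    have := Finset.prod_lt_prod_of_nonempty (s := (Finset.univ : Finset (Fin 5)))
      (f := fun _ => r) (g := fun j => ‖x j‖) (fun _ _ => hr) (fun j _ => hx j) Finset.univ_nonempty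
    simpa using this
  have hpos : 0 < ∏ j, ‖x j‖ := (pow_pos hr 5).trans hr5
  have hlt : ‖p * q * (∏ j, x j)⁻¹‖ < ‖q‖ := by
    rw [norm_mul, norm_mul, norm_inv, norm_prod, ← div_eq_mul_inv, div_lt_iff₀ hpos, mul_comm]
    exact mul_lt_mul_of_pos_left (hpr.trans_lt hr5) (norm_pos_iff.mpr hq0)
  refine ⟨⟨fun j => ?_, ?_⟩, hlt⟩
  · refine Fin.cases ?_ (fun i => ?_) j
    · exact hlt.trans hq
    · exact hx1 i
  · rw [Fin.prod_univ_succ]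
    simp only [Fin.cons_zero, Fin.cons_succ]
    rw [mul_assoc, inv_mul_cancel₀, mul_one]
    rw [← norm_ne_zero_iff, norm_prod]
    exact hpos.ne'

/-- The ratio is constant on the region where all parameters but the first are large. There the
first one stays smaller than `q` while the other five are moved independently of each other. -/
theorem betaRatio_eq_of_lt_norm (hp0 : p ≠ 0) (hp : ‖p‖ < 1) (hq0 : q ≠ 0) (hq : ‖q‖ < 1)
    {r : ℝ} (hr : 0 < r) (hpr : ‖p‖ ≤ r ^ 5) {t u : Fin 6 → ℂ} (ht : IsAdmissible p q t)
    (hu : IsAdmissible p q u) (htr : ∀ j : Fin 5, r < ‖t j.succ‖)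
    (hur : ∀ j : Fin 5, r < ‖u j.succ‖) : betaRatio p q t = betaRatio p q u := by
  have hcons : ∀ {v : Fin 6 → ℂ}, IsAdmissible p q v →
      v = Fin.cons (p * q * (∏ j, Fin.tail v j)⁻¹) (Fin.tail v) := fun {v} hv => by
    rw [← hv.prod_eq, Fin.prod_univ_succ]
    conv_lhs => rw [← Fin.cons_self_tail v]
    congr 1
    have : ∏ j : Fin 5, v j.succ ≠ 0 := Finset.prod_ne_zero_iff.mpr fun j _ => hv.ne_zero hp0 hq0 _
    simp only [Fin.tail]
    field_simp
  -- replace the entries of `t` by those of `u` one after the other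
  let x : ℕ → Fin 5 → ℂ := fun m j => if (j : ℕ) < m then u j.succ else t j.succ
  have hx : ∀ m j, r < ‖x m j‖ := fun m j => by
    simp only [x]; split_ifs; exacts [hur j, htr j]
  have hx1 : ∀ m j, ‖x m j‖ < 1 := fun m j => by
    simp only [x]; split_ifs; exacts [hu.norm_lt_one _, ht.norm_lt_one _]
  have hstep : ∀ m : Fin 5, betaRatio p q (Fin.cons (p * q * (∏ j, x m j)⁻¹) (x m)) =
      betaRatio p q (Fin.cons (p * q * (∏ j, x (m + 1) j)⁻¹) (x (m + 1))) := fun m => by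
    obtain ⟨h1, h2⟩ := isAdmissible_cons hq hr hpr (hx m) (hx1 m) hq0
    obtain ⟨h3, h4⟩ := isAdmissible_cons hq hr hpr (hx (m + 1)) (hx1 (m + 1)) hq0
    refine betaRatio_eq_of_agree hp0 hp hq0 hq h1 h3 (Fin.succ_ne_zero m) (fun j => ?_) h2 h4
    refine Fin.cases (fun h => absurd rfl h) (fun i _ hi => ?_) j
    have hi' : (i : ℕ) ≠ m := fun h => hi (congrArg Fin.succ (Fin.ext h))
    simp only [Fin.cons_succ, x]
    split_ifs <;> first | rfl | omega
  have h0 : x 0 = Fin.tail t := by funext j; simp [x, Fin.tail]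
  have h5 : x 5 = Fin.tail u := by funext j; simp [x, Fin.tail]
  rw [hcons ht, hcons hu, ← h0, ← h5]
  exact (hstep 0).trans ((hstep 1).trans ((hstep 2).trans ((hstep 3).trans (hstep 4))))

/-- The ratio does not depend on the parameters. In logarithmic coordinates the admissible
parameters form a convex set; along the complex line from a point of the region of
`betaRatio_eq_of_lt_norm` to a given point the ratio is holomorphic and locally constant at the
start. -/
theorem betaRatio_eq (hp0 : p ≠ 0) (hp : ‖p‖ < 1) (hq0 : q ≠ 0) (hq : ‖q‖ < 1)
    {t u : Fin 6 → ℂ} (ht : IsAdmissible p q t) (hu : IsAdmissible p q u) :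
    betaRatio p q t = betaRatio p q u := by
  -- logarithmic coordinates, normalized so that they add up to a fixed logarithm of `p q`
  set L : ℂ := Complex.log (p * q) with hL
  have hpq0 : p * q ≠ 0 := mul_ne_zero hp0 hq0
  have hLre : L.re = Real.log ‖p‖ + Real.log ‖q‖ := by
    rw [hL, Complex.log_re, norm_mul,
      Real.log_mul (norm_ne_zero_iff.mpr hp0) (norm_ne_zero_iff.mpr hq0)]
  have hlp : Real.log ‖p‖ < 0 := Real.log_neg (norm_pos_iff.mpr hp0) hp
  have hlq : Real.log ‖q‖ < 0 := Real.log_neg (norm_pos_iff.mpr hq0) hq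
  -- base point: five parameters of norm `‖p‖ ^ (1 / 10)`, which exceeds `‖p‖ ^ (1 / 5)`
  set ε : ℝ := -Real.log ‖p‖ / 10 with hε
  let α : Fin 6 → ℂ := Fin.cons (L + 5 * ε) fun _ => -(ε : ℂ)
  have hαsum : ∑ j, α j = L := by
    rw [Fin.sum_univ_succ]
    simp [α]
  have hαre : ∀ j, (α j).re < 0 := fun j => by
    refine Fin.cases ?_ (fun i => ?_) j
    · have : (α 0).re = L.re + 5 * ε := by simp [α]
      rw [this, hLre, hε]
      linarith
    · have : (α i.succ).re = -ε := by simp [α]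
      rw [this, hε]
      linarith
  set u₀ : Fin 6 → ℂ := fun j => Complex.exp (α j) with hu₀
  have hu₀A : IsAdmissible p q u₀ :=
    ⟨fun j => by simpa [hu₀, Complex.norm_exp] using hαre j, by
      rw [← Complex.exp_sum, hαsum, hL, Complex.exp_log hpq0]⟩
  suffices key : ∀ {v : Fin 6 → ℂ}, IsAdmissible p q v → betaRatio p q v = betaRatio p q u₀ from
    (key ht).trans (key hu).symm
  intro v hv
  have hv0 := hv.ne_zero hp0 hq0
  let w : Fin 6 → ℂ :=
    Fin.cons (L - ∑ j : Fin 5, Complex.log (v j.succ)) fun j => Complex.log (v j.succ)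
  have hwsum : ∑ j, w j = L := by
    rw [Fin.sum_univ_succ]
    simp [w]
  have hwexp : ∀ j, Complex.exp (w j) = v j := fun j => by
    refine Fin.cases ?_ (fun i => ?_) j
    · simp only [w, Fin.cons_zero]
      rw [Complex.exp_sub, hL, Complex.exp_log hpq0, Complex.exp_sum, ← hv.prod_eq,
        Fin.prod_univ_succ, Finset.prod_congr rfl fun j _ => Complex.exp_log (hv0 (Fin.succ j)),
        mul_div_cancel_right₀]
      exact Finset.prod_ne_zero_iff.mpr fun j _ => hv0 _
    · simp only [w, Fin.cons_succ]
      exact Complex.exp_log (hv0 _)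
  let τ : ℂ → Fin 6 → ℂ := fun s j => Complex.exp (α j + s * (w j - α j))
  have hτ0 : τ 0 = u₀ := by
    funext j
    simp [τ, hu₀]
  have hτ1 : τ 1 = v := by
    funext j
    simp [τ, hwexp]
  set U : Set ℂ := {s | ∀ j, (α j + s * (w j - α j)).re < 0} with hU
  have hUo : IsOpen U := by
    rw [hU, Set.ofPred_forall]
    exact isOpen_iInter_of_finite fun j =>
      isOpen_lt (Complex.continuous_re.comp (by fun_prop)) continuous_const
  have hUc : Convex ℝ U := by
    intro x hx y hy a b ha hb hab j
    have h1 : α j + (a • x + b • y) * (w j - α j) =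
        a • (α j + x * (w j - α j)) + b • (α j + y * (w j - α j)) := by
      have : (a : ℂ) + b = 1 := by exact_mod_cast hab
      simp only [Complex.real_smul]
      linear_combination -α j * this
    rw [h1, Complex.add_re, Complex.smul_re, Complex.smul_re, smul_eq_mul, smul_eq_mul]
    have hxj := hx j
    have hyj := hy j
    rcases ha.eq_or_lt with rfl | ha
    · rw [zero_add] at hab
      subst hab
      simpa using hyj
    · nlinarith [mul_pos_of_neg_of_neg (neg_neg_of_pos ha) hxj, mul_nonneg hb (neg_pos.mpr hyj).le]
  have hτA : ∀ s ∈ U, IsAdmissible p q (τ s) := fun s hs => by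
    refine ⟨fun j => ?_, ?_⟩
    · simpa [τ, Complex.norm_exp] using hs j
    · simp only [τ]
      rw [← Complex.exp_sum, Finset.sum_add_distrib, ← Finset.mul_sum, Finset.sum_sub_distrib,
        hαsum, hwsum, sub_self, mul_zero, add_zero, hL, Complex.exp_log hpq0]
  have h0U : (0 : ℂ) ∈ U := fun j => by simpa using hαre j
  have h1U : (1 : ℂ) ∈ U := fun j => by
    have h := hv.norm_lt_one j
    rw [← hwexp, Complex.norm_exp, Real.exp_lt_one_iff] at h
    simpa using h
  have hF : DifferentiableOn ℂ (fun s => betaRatio p q (τ s)) U :=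
    differentiableOn_betaRatio hUo hp0 hq0 hp hq (fun j => by fun_prop) hτA
  set r : ℝ := Real.exp (Real.log ‖p‖ / 5) with hr
  have hr5 : ‖p‖ ≤ r ^ 5 := by
    rw [hr, ← Real.exp_nat_mul]
    push_cast
    rw [mul_div_cancel₀ _ (by norm_num : (5 : ℝ) ≠ 0), Real.exp_log (norm_pos_iff.mpr hp0)]
  have hτr : ∀ j : Fin 5, ∀ᶠ s in nhds (0 : ℂ), r < ‖τ s j.succ‖ := fun j => by
    have hc : Continuous fun s => ‖τ s j.succ‖ := by fun_prop
    refine hc.continuousAt.eventually (lt_mem_nhds ?_)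
    have : ‖τ 0 j.succ‖ = Real.exp (-ε) := by
      simp [τ, α, Complex.norm_exp]
    change r < ‖τ 0 j.succ‖
    rw [this, hr, Real.exp_lt_exp, hε]
    linarith
  have hloc : (fun s => betaRatio p q (τ s)) =ᶠ[nhds 0] fun _ => betaRatio p q u₀ := by
    filter_upwards [Filter.eventually_all.mpr hτr, hUo.mem_nhds h0U] with s hs hsU
    rw [← hτ0]
    exact betaRatio_eq_of_lt_norm hp0 hp hq0 hq (Real.exp_pos _) hr5 (hτA s hsU) (hτA 0 h0U) hs
      fun j => (hτr j).self_of_nhds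
  have := (hF.analyticOnNhd hUo).eqOn_of_preconnected_of_eventuallyEq
    (analyticOnNhd_const) hUc.isPreconnected h0U hloc h1U
  simpa [hτ1] using this

end Constancy

/-! ### Evaluation of the constant -/

section Evaluation

variable {p q : ℂ}

/-- The elliptic gamma function with its pole at `1` removed: `(1 - x) Γ(x; p, q)`, written so that
it is regular at `x = 1`. -/
noncomputable def gammaReg (p q x : ℂ) : ℂ :=
  pqShifted (p * q * x⁻¹) p q / (qShifted (p * x) p * pqShifted (q * x) p q)

theorem ellipticGamma_eq_gammaReg (hp : ‖p‖ < 1) (hq : ‖q‖ < 1) (x : ℂ) :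
    ellipticGamma x p q = gammaReg p q x / (1 - x) := by
  rw [ellipticGamma, gammaReg, pqShifted_eq_qShifted_mul' x hp hq, qShifted_eq_one_sub_mul x hp,
    div_div]
  congr 1
  ring

theorem gammaReg_denom_ne_zero (hp : ‖p‖ < 1) (hq : ‖q‖ < 1) {x : ℂ} (hx : ‖x‖ ≤ 1) :
    qShifted (p * x) p * pqShifted (q * x) p q ≠ 0 := by
  refine mul_ne_zero (qShifted_ne_zero_of_norm_lt_one hp ?_)
    (pqShifted_ne_zero_of_norm_lt_one hp hq ?_) <;> rw [norm_mul]
  exacts [mul_lt_one_of_nonneg_of_lt_one_left (norm_nonneg _) hp hx,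
    mul_lt_one_of_nonneg_of_lt_one_left (norm_nonneg _) hq hx]

theorem gammaReg_ne_zero (hp : ‖p‖ < 1) (hq : ‖q‖ < 1) {x : ℂ} (hx : ‖x‖ ≤ 1)
    (hx' : ‖p * q * x⁻¹‖ < 1) : gammaReg p q x ≠ 0 :=
  div_ne_zero (pqShifted_ne_zero_of_norm_lt_one hp hq hx') (gammaReg_denom_ne_zero hp hq hx)

theorem continuousOn_gammaReg_comp {X : Type*} [TopologicalSpace X] {f : X → ℂ} {s : Set X}
    (hp : ‖p‖ < 1) (hq : ‖q‖ < 1) (hf : ContinuousOn f s) (h0 : ∀ x ∈ s, f x ≠ 0)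
    (h1 : ∀ x ∈ s, ‖f x‖ ≤ 1) : ContinuousOn (fun x => gammaReg p q (f x)) s :=
  ((differentiable_pqShifted hp hq).continuous.comp_continuousOn
    (continuousOn_const.mul (hf.inv₀ h0))).div
    (((differentiable_qShifted hp).continuous.comp_continuousOn (continuousOn_const.mul hf)).mul
    ((differentiable_pqShifted hp hq).continuous.comp_continuousOn (continuousOn_const.mul hf)))
    fun x hx => gammaReg_denom_ne_zero hp hq (h1 x hx)

/-- The residue of the elliptic gamma function at `1`, up to sign. -/
theorem gammaReg_one (hp : ‖p‖ < 1) (hq : ‖q‖ < 1) :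
    gammaReg p q 1 = (qShifted p p * qShifted q q)⁻¹ := by
  have h1 := pqShifted_eq_qShifted_mul q hp hq
  have h2 : pqShifted (p * q) p q ≠ 0 := pqShifted_ne_zero_of_norm_lt_one hp hq (by
    rw [norm_mul]; exact mul_lt_one_of_nonneg_of_lt_one_left (norm_nonneg _) hp hq.le)
  rw [gammaReg, inv_one, mul_one, mul_one, mul_one, h1, ← mul_assoc]
  field_simp

theorem norm_mul_lt_one_of_lt {x y : ℂ} (hx : ‖x‖ < 1) (hy : ‖y‖ ≤ 1) : ‖x * y‖ < 1 := by
  rw [norm_mul]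
  exact mul_lt_one_of_nonneg_of_lt_one_left (norm_nonneg _) hx hy

/-- The value `(1 - x)² = 4` at `x = -1`, from the reflection formula `inv_ellipticGamma_sq`. -/
theorem gammaReg_neg_one_sq_mul (hp : ‖p‖ < 1) (hq : ‖q‖ < 1) :
    gammaReg p q (-1) ^ 2 * (theta q (-1) * theta p (-1)) = 4 := by
  have h1 := inv_ellipticGamma_sq hp hq (y := -1) (by simp)
  have h2 : gammaReg p q (-1) ≠ 0 := gammaReg_ne_zero hp hq (by simp) (by
    have := norm_mul_lt_one_of_lt hp hq.le
    simpa [inv_neg] using this)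
  rw [inv_neg, inv_one, ellipticGamma_eq_gammaReg hp hq] at h1
  rw [← h1]
  field_simp
  norm_num

/-- Parameters approaching the boundary point `(i, -i, κ, κ, κ, κ)` as `s → 1`. Their product is
`κ ^ 4` for every `s`. As `s → 1` the poles of the integrand inside and outside the circle pinch
it at the points `±i`. -/
noncomputable def limitParams (κ : ℂ) (s : ℝ) : Fin 6 → ℂ :=
  ![Complex.I * √s, -(Complex.I * √s), κ / √(√s), κ / √(√s), κ / √(√s), κ / √(√s)]

theorem isAdmissible_limitParams {κ : ℂ} (hκ : κ ^ 4 = p * q) {s : ℝ} (hs : ‖κ‖ ^ 4 < s)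
    (hs1 : s < 1) : IsAdmissible p q (limitParams κ s) := by
  have hs0 : 0 < s := (by positivity : 0 ≤ ‖κ‖ ^ 4).trans_lt hs
  have hr : √s < 1 := by rw [Real.sqrt_lt' one_pos]; simpa using hs1
  have h1 : ‖Complex.I * (√s : ℂ)‖ < 1 := by
    rw [norm_mul, Complex.norm_I, one_mul, Complex.norm_real, Real.norm_of_nonneg (Real.sqrt_nonneg _)]
    exact hr
  have h2 : ‖κ / (√(√s) : ℂ)‖ < 1 := by
    have hpos : 0 < √(√s) := Real.sqrt_pos.mpr (Real.sqrt_pos.mpr hs0)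
    rw [norm_div, Complex.norm_real, Real.norm_of_nonneg hpos.le, div_lt_one hpos,
      Real.lt_sqrt (norm_nonneg _), Real.lt_sqrt (by positivity)]
    calc (‖κ‖ ^ 2) ^ 2 = ‖κ‖ ^ 4 := by ring
      _ < s := hs
  refine ⟨fun j => ?_, ?_⟩
  · fin_cases j
    exacts [h1, by simpa [limitParams] using h1, h2, h2, h2, h2]
  · have e1 : ((√(√s) : ℝ) : ℂ) ^ 4 = s := by
      have : √(√s) ^ 4 = s := by
        rw [show √(√s) ^ 4 = (√(√s) ^ 2) ^ 2 by ring, Real.sq_sqrt (Real.sqrt_nonneg _),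
          Real.sq_sqrt hs0.le]
      exact_mod_cast this
    have e2 : ((√s : ℝ) : ℂ) ^ 2 = s := by exact_mod_cast Real.sq_sqrt hs0.le
    have hs0' : (s : ℂ) ≠ 0 := by exact_mod_cast hs0.ne'
    rw [Fin.prod_univ_six]
    simp only [limitParams, Matrix.cons_val]
    calc _ = (-(Complex.I ^ 2) * (√s : ℂ) ^ 2) * (κ ^ 4 / (√(√s) : ℂ) ^ 4) := by ring
      _ = p * q := by
        rw [Complex.I_sq, e1, e2, hκ]
        field_simp

/-- The quotient of integrand and product at `limitParams κ s`, with the factors that degenerate as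
`s → 1` removed; they make up the Poisson kernel. -/
noncomputable def limitDensity (p q κ : ℂ) (s : ℝ) (z : ℂ) : ℂ :=
  (gammaReg p q (Complex.I * √s * z) * gammaReg p q (Complex.I * √s * z⁻¹) *
    (gammaReg p q (-(Complex.I * √s) * z) * gammaReg p q (-(Complex.I * √s) * z⁻¹)) *
    (ellipticGamma (κ / √(√s) * z) p q * ellipticGamma (κ / √(√s) * z⁻¹) p q) ^ 4 *
    (theta q (z ^ 2) * theta p (z ^ 2)⁻¹)) /
  ((1 + s) * gammaReg p q s * (ellipticGamma (Complex.I * √s * (κ / √(√s))) p q ^ 4 *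
    ellipticGamma (-(Complex.I * √s) * (κ / √(√s))) p q ^ 4 *
    ellipticGamma (κ / √(√s) * (κ / √(√s))) p q ^ 6))

/-- The four factors of the integrand that become singular at `z = ±i` have the product of
denominators `|1 + s z²|²`, and the one factor `Γ(s; p, q)` of `betaProduct` that becomes singular
contributes `1 - s`: together they are the Poisson kernel. -/
theorem betaRatio_limitParams (hp : ‖p‖ < 1) (hq : ‖q‖ < 1) (κ : ℂ) {s : ℝ} (hs0 : 0 < s)
    (hs1 : s < 1) : betaRatio p q (limitParams κ s) = Real.circleAverage (fun z =>
      (((1 - s ^ 2) / ‖1 + s * z ^ 2‖ ^ 2 : ℝ) : ℂ) * limitDensity p q κ s z) 0 1 := by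
  have e2 : ((√s : ℝ) : ℂ) ^ 2 = s := by exact_mod_cast Real.sq_sqrt hs0.le
  have hs1' : (1 - s : ℂ) ≠ 0 := by
    rw [sub_ne_zero]; exact_mod_cast hs1.ne'
  have hs2 : (1 + s : ℂ) ≠ 0 := by
    have : (1 + s : ℝ) ≠ 0 := by positivity
    exact_mod_cast this
  rw [betaRatio, div_eq_mul_inv, mul_comm, ← smul_eq_mul, ← Real.circleAverage_fun_smul]
  refine Real.circleAverage_congr_sphere fun z hz => ?_
  have hz1 : ‖z‖ = 1 := by simpa using hz
  have hz0 : z ≠ 0 := norm_pos_iff.mp (by rw [hz1]; exact one_pos)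
  have hconj : (starRingEnd ℂ) z = z⁻¹ := by
    rw [Complex.inv_def, Complex.normSq_eq_norm_sq, hz1]; simp
  have hn : ((‖1 + s * z ^ 2‖ ^ 2 : ℝ) : ℂ) =
      ((1 - Complex.I * √s * z) * (1 - -(Complex.I * √s) * z)) *
      ((1 - Complex.I * √s * z⁻¹) * (1 - -(Complex.I * √s) * z⁻¹)) := by
    rw [← Complex.normSq_eq_norm_sq, Complex.normSq_eq_conj_mul_self]
    simp only [map_add, map_one, map_mul, map_pow, Complex.conj_ofReal, hconj]
    rw [← e2]
    linear_combination ((√s : ℂ) ^ 2 * z ^ 2 + (√s : ℂ) ^ 2 * z⁻¹ ^ 2 -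
      (√s : ℂ) ^ 4 * z ^ 2 * z⁻¹ ^ 2 * (Complex.I ^ 2 - 1)) * Complex.I_sq
  have h01 : Complex.I * √s * -(Complex.I * √s) = s := by
    rw [← e2]
    linear_combination -(√s : ℂ) ^ 2 * Complex.I_sq
  rw [Complex.ofReal_div, hn, betaKernel, betaProduct_expand, Fin.prod_univ_six]
  simp only [limitParams, Matrix.cons_val, h01, limitDensity, smul_eq_mul]
  rw [ellipticGamma_eq_gammaReg hp hq (s : ℂ), ellipticGamma_eq_gammaReg hp hq (Complex.I * √s * z),
    ellipticGamma_eq_gammaReg hp hq (Complex.I * √s * z⁻¹),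
    ellipticGamma_eq_gammaReg hp hq (-(Complex.I * √s) * z),
    ellipticGamma_eq_gammaReg hp hq (-(Complex.I * √s) * z⁻¹)]
  have hfac : ((1 - s ^ 2 : ℝ) : ℂ) = (1 - s) * (1 + s) := by push_cast; ring
  rw [hfac]
  generalize gammaReg p q (Complex.I * √s * z) = g₁
  generalize gammaReg p q (Complex.I * √s * z⁻¹) = g₂
  generalize gammaReg p q (-(Complex.I * √s) * z) = g₃
  generalize gammaReg p q (-(Complex.I * √s) * z⁻¹) = g₄
  generalize (1 - Complex.I * √s * z) = x₁
  generalize (1 - Complex.I * √s * z⁻¹) = x₂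
  generalize (1 - -(Complex.I * √s) * z) = x₃
  generalize (1 - -(Complex.I * √s) * z⁻¹) = x₄
  generalize (1 - (s : ℂ)) = y at hs1' ⊢
  generalize (1 + (s : ℂ)) = w at hs2 ⊢
  simp only [div_eq_mul_inv, mul_inv, inv_inv]
  ring_nf
  rw [mul_inv_cancel_right₀ hs2]

theorem norm_bounds_of_mem_Icc {κ : ℂ} {a s : ℝ} (ha : ‖κ‖ ^ 4 < a) (hs : s ∈ Set.Icc a 1) :
    0 < s ∧ 0 < √s ∧ √s ≤ 1 ∧ 0 < √(√s) ∧ √(√s) ≤ 1 ∧ ‖κ‖ < √(√s) := by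
  have hs' : ‖κ‖ ^ 4 < s := ha.trans_le hs.1
  have hs0 : 0 < s := (by positivity : 0 ≤ ‖κ‖ ^ 4).trans_lt hs'
  have h1 : 0 < √s := Real.sqrt_pos.mpr hs0
  have h2 : √s ≤ 1 := Real.sqrt_le_iff.mpr ⟨zero_le_one, by simpa using hs.2⟩
  refine ⟨hs0, h1, h2, Real.sqrt_pos.mpr h1, Real.sqrt_le_iff.mpr ⟨zero_le_one, by simpa using hs.2⟩, ?_⟩
  rw [Real.lt_sqrt (norm_nonneg _), Real.lt_sqrt (by positivity)]
  calc (‖κ‖ ^ 2) ^ 2 = ‖κ‖ ^ 4 := by ring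
    _ < s := hs'

/-- The density is continuous up to and including `s = 1`. -/
theorem continuousOn_limitDensity (hp0 : p ≠ 0) (hq0 : q ≠ 0) (hp : ‖p‖ < 1) (hq : ‖q‖ < 1) {κ : ℂ}
    (hκ : κ ^ 4 = p * q) {a : ℝ} (ha : ‖κ‖ ^ 4 < a) :
    ContinuousOn (fun x : ℝ × ℂ => limitDensity p q κ x.1 x.2)
      (Set.Icc a 1 ×ˢ Metric.sphere 0 1) := by
  have hκ0 : κ ≠ 0 := by
    rintro rfl
    exact mul_ne_zero hp0 hq0 (by rw [← hκ]; norm_num)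
  have hκn : 0 < ‖κ‖ := norm_pos_iff.mpr hκ0
  have hb := fun (x : ℝ × ℂ) (hx : x ∈ Set.Icc a 1 ×ˢ Metric.sphere (0 : ℂ) 1) =>
    norm_bounds_of_mem_Icc ha hx.1
  have hz : ∀ x ∈ Set.Icc a 1 ×ˢ Metric.sphere (0 : ℂ) 1, ‖x.2‖ = 1 := fun x hx => by simpa using hx.2
  have hz0 : ∀ x ∈ Set.Icc a 1 ×ˢ Metric.sphere (0 : ℂ) 1, x.2 ≠ 0 := fun x hx =>
    norm_pos_iff.mp (by rw [hz x hx]; exact one_pos)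
  have hI : ∀ x : ℝ × ℂ, ‖Complex.I * (√x.1 : ℂ)‖ = √x.1 := fun x => by
    rw [norm_mul, Complex.norm_I, one_mul, Complex.norm_real, Real.norm_of_nonneg (Real.sqrt_nonneg _)]
  have hI0 : ∀ x ∈ Set.Icc a 1 ×ˢ Metric.sphere (0 : ℂ) 1, Complex.I * (√x.1 : ℂ) ≠ 0 := fun x hx =>
    norm_pos_iff.mp (by rw [hI]; exact (hb x hx).2.1)
  have hK : ∀ x : ℝ × ℂ, ‖κ / (√(√x.1) : ℂ)‖ = ‖κ‖ / √(√x.1) := fun x => by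
    rw [norm_div, Complex.norm_real, Real.norm_of_nonneg (Real.sqrt_nonneg _)]
  have hK1 : ∀ x ∈ Set.Icc a 1 ×ˢ Metric.sphere (0 : ℂ) 1, ‖κ / (√(√x.1) : ℂ)‖ < 1 := fun x hx => by
    rw [hK, div_lt_one (hb x hx).2.2.2.1]
    exact (hb x hx).2.2.2.2.2
  have hK0 : ∀ x ∈ Set.Icc a 1 ×ˢ Metric.sphere (0 : ℂ) 1, κ / (√(√x.1) : ℂ) ≠ 0 := fun x hx =>
    norm_pos_iff.mp (by rw [hK]; exact div_pos hκn (hb x hx).2.2.2.1)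
  have hIc : ContinuousOn (fun x : ℝ × ℂ => Complex.I * (√x.1 : ℂ))
      (Set.Icc a 1 ×ˢ Metric.sphere (0 : ℂ) 1) := by fun_prop
  have hKc : ContinuousOn (fun x : ℝ × ℂ => κ / (√(√x.1) : ℂ))
      (Set.Icc a 1 ×ˢ Metric.sphere (0 : ℂ) 1) :=
    continuousOn_const.div (by fun_prop) fun x hx => by exact_mod_cast (hb x hx).2.2.2.1.ne'
  have hinv : ContinuousOn (fun x : ℝ × ℂ => x.2⁻¹) (Set.Icc a 1 ×ˢ Metric.sphere (0 : ℂ) 1) :=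
    continuousOn_snd.inv₀ hz0
  have hsq : ContinuousOn (fun x : ℝ × ℂ => (x.2 ^ 2)⁻¹) (Set.Icc a 1 ×ˢ Metric.sphere (0 : ℂ) 1) :=
    (continuousOn_snd.pow 2).inv₀ fun x hx => pow_ne_zero 2 (hz0 x hx)
  have hκ1 : ∀ x ∈ Set.Icc a 1 ×ˢ Metric.sphere (0 : ℂ) 1, ‖κ‖ < 1 := fun x hx =>
    (hb x hx).2.2.2.2.2.trans_le (hb x hx).2.2.2.2.1
  have hpq : ‖p * q‖ = ‖κ‖ ^ 4 := by rw [← hκ, norm_pow]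
  -- the factors of the denominator
  have hIK : ∀ x ∈ Set.Icc a 1 ×ˢ Metric.sphere (0 : ℂ) 1,
      ‖Complex.I * √x.1 * (κ / √(√x.1))‖ < 1 ∧
      ‖p * q * (Complex.I * √x.1 * (κ / √(√x.1)))⁻¹‖ < 1 := fun x hx => by
    obtain ⟨h0, h1, h2, h3, h4, h5⟩ := hb x hx
    refine ⟨?_, ?_⟩
    · rw [mul_comm]
      exact norm_mul_lt_one_of_lt (hK1 x hx) ((hI x).trans_le h2)
    · have hsq : √x.1 = √(√x.1) ^ 2 := (Real.sq_sqrt h1.le).symm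
      rw [norm_mul (p * q), norm_inv, hpq, norm_mul, hI, hK, ← div_eq_mul_inv,
        div_lt_one (by positivity)]
      have e1 : √x.1 * (‖κ‖ / √(√x.1)) = √(√x.1) * ‖κ‖ := by
        rw [hsq, Real.sqrt_sq h3.le]
        field_simp
      rw [e1]
      calc ‖κ‖ ^ 4 = ‖κ‖ ^ 3 * ‖κ‖ := by ring
        _ ≤ ‖κ‖ ^ 1 * ‖κ‖ := mul_le_mul_of_nonneg_right
          (pow_le_pow_of_le_one hκn.le (hκ1 x hx).le (by norm_num)) hκn.le
        _ < √(√x.1) * ‖κ‖ := by rw [pow_one]; exact mul_lt_mul_of_pos_right h5 hκn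
  have hKK : ∀ x ∈ Set.Icc a 1 ×ˢ Metric.sphere (0 : ℂ) 1,
      ‖κ / (√(√x.1) : ℂ) * (κ / √(√x.1))‖ < 1 ∧
      ‖p * q * (κ / (√(√x.1) : ℂ) * (κ / √(√x.1)))⁻¹‖ < 1 := fun x hx => by
    obtain ⟨h0, h1, h2, h3, h4, h5⟩ := hb x hx
    refine ⟨norm_mul_lt_one_of_lt (hK1 x hx) (hK1 x hx).le, ?_⟩
    rw [norm_mul (p * q), norm_inv, hpq, norm_mul, hK]
    have e1 : ‖κ‖ ^ 4 * (‖κ‖ / √(√x.1) * (‖κ‖ / √(√x.1)))⁻¹ = (‖κ‖ * √(√x.1)) ^ 2 := by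
      field_simp
    rw [e1]
    have : ‖κ‖ * √(√x.1) < 1 := mul_lt_one_of_nonneg_of_lt_one_left hκn.le (hκ1 x hx) h4
    exact pow_lt_one₀ (by positivity) this (by norm_num)
  have hss : ∀ x ∈ Set.Icc a 1 ×ˢ Metric.sphere (0 : ℂ) 1, (x.1 : ℂ) ≠ 0 ∧ ‖(x.1 : ℂ)‖ ≤ 1 ∧
      ‖p * q * (x.1 : ℂ)⁻¹‖ < 1 := fun x hx => by
    obtain ⟨h0, -⟩ := hb x hx
    refine ⟨by exact_mod_cast h0.ne', ?_, ?_⟩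
    · rw [Complex.norm_real, Real.norm_of_nonneg h0.le]; exact hx.1.2
    · rw [norm_mul, norm_inv, Complex.norm_real, Real.norm_of_nonneg h0.le, hpq, ← div_eq_mul_inv,
        div_lt_one h0]
      exact ha.trans_le hx.1.1
  have hreg : ∀ {f g : ℝ × ℂ → ℂ}, ContinuousOn f (Set.Icc a 1 ×ˢ Metric.sphere (0 : ℂ) 1) →
      ContinuousOn g (Set.Icc a 1 ×ˢ Metric.sphere (0 : ℂ) 1) →
      (∀ x ∈ Set.Icc a 1 ×ˢ Metric.sphere (0 : ℂ) 1, f x ≠ 0 ∧ ‖f x‖ ≤ 1) →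
      (∀ x ∈ Set.Icc a 1 ×ˢ Metric.sphere (0 : ℂ) 1, ‖g x‖ = 1) →
      ContinuousOn (fun x => gammaReg p q (f x * g x)) (Set.Icc a 1 ×ˢ Metric.sphere (0 : ℂ) 1) :=
    fun {f g} hf hg hf1 hg1 => continuousOn_gammaReg_comp hp hq (hf.mul hg)
      (fun x hx => mul_ne_zero (hf1 x hx).1 (norm_pos_iff.mp (by rw [hg1 x hx]; exact one_pos)))
      fun x hx => by rw [norm_mul, hg1 x hx, mul_one]; exact (hf1 x hx).2
  have hell : ∀ {g : ℝ × ℂ → ℂ}, ContinuousOn g (Set.Icc a 1 ×ˢ Metric.sphere (0 : ℂ) 1) →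
      (∀ x ∈ Set.Icc a 1 ×ˢ Metric.sphere (0 : ℂ) 1, ‖g x‖ = 1) →
      ContinuousOn (fun x => ellipticGamma (κ / √(√x.1) * g x) p q)
        (Set.Icc a 1 ×ˢ Metric.sphere (0 : ℂ) 1) :=
    fun {g} hg hg1 => continuousOn_ellipticGamma_comp hp hq (hKc.mul hg)
      (fun x hx => mul_ne_zero (hK0 x hx) (norm_pos_iff.mp (by rw [hg1 x hx]; exact one_pos)))
      fun x hx => by rw [norm_mul, hg1 x hx, mul_one]; exact hK1 x hx
  have hzi : ∀ x ∈ Set.Icc a 1 ×ˢ Metric.sphere (0 : ℂ) 1, ‖x.2⁻¹‖ = 1 := fun x hx => by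
    rw [norm_inv, hz x hx, inv_one]
  have hI1 : ∀ x ∈ Set.Icc a 1 ×ˢ Metric.sphere (0 : ℂ) 1,
      Complex.I * (√x.1 : ℂ) ≠ 0 ∧ ‖Complex.I * (√x.1 : ℂ)‖ ≤ 1 := fun x hx =>
    ⟨hI0 x hx, (hI x).trans_le (hb x hx).2.2.1⟩
  have hI1' : ∀ x ∈ Set.Icc a 1 ×ˢ Metric.sphere (0 : ℂ) 1,
      -(Complex.I * (√x.1 : ℂ)) ≠ 0 ∧ ‖-(Complex.I * (√x.1 : ℂ))‖ ≤ 1 := fun x hx =>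
    ⟨neg_ne_zero.mpr (hI1 x hx).1, by rw [norm_neg]; exact (hI1 x hx).2⟩
  refine ContinuousOn.div ?_ ?_ fun x hx => ?_
  · refine ContinuousOn.mul (ContinuousOn.mul (ContinuousOn.mul (ContinuousOn.mul
      (hreg hIc continuousOn_snd hI1 hz) (hreg hIc hinv hI1 hzi)) (ContinuousOn.mul
      (hreg hIc.neg continuousOn_snd hI1' hz) (hreg hIc.neg hinv hI1' hzi))) (ContinuousOn.pow
      (ContinuousOn.mul (hell continuousOn_snd hz) (hell hinv hzi)) 4)) (ContinuousOn.mul ?_ ?_)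
    · exact (differentiableOn_theta hq).continuousOn.comp (continuousOn_snd.pow 2)
        fun x hx => pow_ne_zero 2 (hz0 x hx)
    · exact (differentiableOn_theta hp).continuousOn.comp hsq
        fun x hx => inv_ne_zero (pow_ne_zero 2 (hz0 x hx))
  · refine ContinuousOn.mul (ContinuousOn.mul (by fun_prop) ?_) (ContinuousOn.mul (ContinuousOn.mul
      (ContinuousOn.pow ?_ 4) (ContinuousOn.pow ?_ 4)) (ContinuousOn.pow ?_ 6))
    · exact continuousOn_gammaReg_comp hp hq (by fun_prop) (fun x hx => (hss x hx).1)
        fun x hx => (hss x hx).2.1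
    · exact continuousOn_ellipticGamma_comp hp hq (hIc.mul hKc)
        (fun x hx => mul_ne_zero (hI0 x hx) (hK0 x hx)) fun x hx => (hIK x hx).1
    · exact continuousOn_ellipticGamma_comp hp hq (hIc.neg.mul hKc)
        (fun x hx => mul_ne_zero (hI1' x hx).1 (hK0 x hx)) fun x hx => by
          simpa only [neg_mul, norm_neg] using (hIK x hx).1
    · exact continuousOn_ellipticGamma_comp hp hq (hKc.mul hKc)
        (fun x hx => mul_ne_zero (hK0 x hx) (hK0 x hx)) fun x hx => (hKK x hx).1
  · refine mul_ne_zero (mul_ne_zero ?_ (gammaReg_ne_zero hp hq (hss x hx).2.1 (hss x hx).2.2))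
      (mul_ne_zero (mul_ne_zero (pow_ne_zero 4 ?_) (pow_ne_zero 4 ?_)) (pow_ne_zero 6 ?_))
    · have : (1 + x.1 : ℝ) ≠ 0 := by have := (hb x hx).1; positivity
      exact_mod_cast this
    · exact ellipticGamma_ne_zero hp hq (hIK x hx).1 (hIK x hx).2
    · exact ellipticGamma_ne_zero hp hq (by simpa only [neg_mul, norm_neg] using (hIK x hx).1)
        (by simpa only [neg_mul, inv_neg, mul_neg, norm_neg] using (hIK x hx).2)
    · exact ellipticGamma_ne_zero hp hq (hKK x hx).1 (hKK x hx).2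

/-- The density at the two peaks. The factors `Γ(±i κ; p, q)` cancel, and `Γ(κ²; p, q) = 1` because
`κ² κ² = p q`. -/
theorem limitDensity_one (hp0 : p ≠ 0) (hq0 : q ≠ 0) (hp : ‖p‖ < 1) (hq : ‖q‖ < 1) {κ : ℂ}
    (hκ : κ ^ 4 = p * q) {z : ℂ} (hz : z ^ 2 = -1) :
    limitDensity p q κ 1 z = 2 * (qShifted p p * qShifted q q)⁻¹ := by
  have hκ0 : κ ≠ 0 := by
    rintro rfl
    exact mul_ne_zero hp0 hq0 (by rw [← hκ]; norm_num)
  have hκn : 0 < ‖κ‖ := norm_pos_iff.mpr hκ0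
  have hκ4 : ‖κ‖ ^ 4 < 1 := by
    rw [← norm_pow, hκ]
    exact norm_mul_lt_one_of_lt hp hq.le
  have hκ1 : ‖κ‖ < 1 := by
    by_contra h
    exact absurd (one_le_pow₀ (not_lt.mp h) (n := 4)) (not_le.mpr hκ4)
  have hpq : ‖p * q‖ = ‖κ‖ ^ 4 := by rw [← hκ, norm_pow]
  have hΓκ : ellipticGamma (κ * κ) p q = 1 := by
    have h1 : p * q * (κ * κ)⁻¹ = κ * κ := by
      rw [← hκ]
      field_simp
    rw [ellipticGamma, h1, div_self]
    exact pqShifted_ne_zero_of_norm_lt_one hp hq (norm_mul_lt_one_of_lt hκ1 hκ1.le)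
  have hne : ∀ {x : ℂ}, ‖x‖ = ‖κ‖ → ellipticGamma x p q ≠ 0 := fun {x} hx => by
    refine ellipticGamma_ne_zero hp hq (hx ▸ hκ1) ?_
    rw [norm_mul, norm_inv, hpq, hx]
    calc ‖κ‖ ^ 4 * ‖κ‖⁻¹ = ‖κ‖ ^ 3 := by field_simp
      _ < 1 := pow_lt_one₀ hκn.le hκ1 (by norm_num)
  have hz' : z = Complex.I ∨ z = -Complex.I := by
    rw [← sq_eq_sq_iff_eq_or_eq_neg, hz, Complex.I_sq]
  have hX : ellipticGamma (Complex.I * κ) p q ≠ 0 := hne (by rw [norm_mul, Complex.norm_I, one_mul])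
  have hY : ellipticGamma (-(Complex.I * κ)) p q ≠ 0 :=
    hne (by rw [norm_neg, norm_mul, Complex.norm_I, one_mul])
  have hneg := gammaReg_neg_one_sq_mul hp hq
  have hone : gammaReg p q 1 ≠ 0 := gammaReg_ne_zero hp hq (by simp) (by
    rw [inv_one, mul_one, hpq]; exact hκ4)
  have hI : Complex.I * Complex.I = -1 := Complex.I_mul_I
  rw [← gammaReg_one hp hq, limitDensity, hz]
  simp only [Real.sqrt_one, Complex.ofReal_one, mul_one, div_one, hΓκ, one_pow, inv_neg, inv_one,
    neg_mul]
  rcases hz' with rfl | rfl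
  · simp only [hI, neg_neg, mul_comm κ, Complex.inv_I, neg_mul, mul_neg]
    rw [div_eq_iff (by simp [hX, hY, hone])]
    linear_combination (gammaReg p q 1 ^ 2 * (ellipticGamma (Complex.I * κ) p q *
      ellipticGamma (-(Complex.I * κ)) p q) ^ 4) * hneg
  · simp only [hI, neg_neg, mul_comm κ, Complex.inv_I, neg_mul, mul_neg, inv_neg]
    rw [div_eq_iff (by simp [hX, hY, hone])]
    linear_combination (gammaReg p q 1 ^ 2 * (ellipticGamma (Complex.I * κ) p q *
      ellipticGamma (-(Complex.I * κ)) p q) ^ 4) * hneg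

/-- The constant value of the ratio: the common value of `limitDensity` at the two peaks. -/
theorem betaRatio_eq_const (hp0 : p ≠ 0) (hq0 : q ≠ 0) (hp : ‖p‖ < 1) (hq : ‖q‖ < 1)
    {t : Fin 6 → ℂ} (ht : IsAdmissible p q t) :
    betaRatio p q t = 2 * (qShifted p p * qShifted q q)⁻¹ := by
  obtain ⟨κ, hκ⟩ := IsAlgClosed.exists_pow_nat_eq (p * q) (n := 4) (by norm_num)
  have hκ4 : ‖κ‖ ^ 4 < 1 := by
    rw [← norm_pow, hκ]
    exact norm_mul_lt_one_of_lt hp hq.le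
  obtain ⟨a, ha, ha1⟩ := exists_between hκ4
  have ha0 : 0 ≤ a := (by positivity : 0 ≤ ‖κ‖ ^ 4).trans ha.le
  have hlim := tendsto_circleAverage_poisson_sq ha0 ha1
    (continuousOn_limitDensity hp0 hq0 hp hq hκ ha) fun z hz => limitDensity_one hp0 hq0 hp hq hκ hz
  refine tendsto_nhds_unique (Filter.Tendsto.congr' ?_ tendsto_const_nhds) hlim
  filter_upwards [self_mem_nhdsWithin, nhdsWithin_le_nhds (lt_mem_nhds ha1)] with s hs1 hs
  rw [← betaRatio_limitParams hp hq κ (ha0.trans_lt hs) hs1]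
  exact betaRatio_eq hp0 hp hq0 hq ht (isAdmissible_limitParams hκ (ha.trans hs) hs1)

end Evaluation

theorem theorem1 (p q : ℂ) (t : Fin 6 → ℂ)
    (hp0 : p ≠ 0) (hq0 : q ≠ 0) (hp : ‖p‖ < 1) (hq : ‖q‖ < 1)
    (ht : ∀ j, ‖t j‖ < 1) (hbal : ∏ j, t j = p * q) :
    CircleIntegrable (ellipticBetaIntegrand t p q) 0 1 ∧
    qShifted p p * qShifted q q / (4 * (Real.pi : ℂ) * Complex.I) *
        (∮ z in C(0, 1), ellipticBetaIntegrand t p q z) =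
      ∏ j, ∏ k ∈ Finset.Ioi j, ellipticGamma (t j * t k) p q := by
  have hA : IsAdmissible p q t := ⟨ht, hbal⟩
  have heq : ∀ z ∈ Metric.sphere (0 : ℂ) 1,
      ellipticBetaIntegrand t p q z = (z - 0)⁻¹ • betaKernel p q t z := fun z hz => by
    rw [ellipticBetaIntegrand_eq hp hq t (by simpa using hz), sub_zero, smul_eq_mul]
  have hcont : ContinuousOn (ellipticBetaIntegrand t p q) (Metric.sphere 0 1) := by
    refine ContinuousOn.congr (f := fun z => (z - 0)⁻¹ • betaKernel p q t z)
      (ContinuousOn.smul (f := fun z : ℂ => (z - 0)⁻¹)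
      (ContinuousOn.inv₀ (f := fun z : ℂ => z - 0) (by fun_prop) fun z hz => ?_)
      (continuousOn_betaKernel_sphere hp hq (hA.ne_zero hp0 hq0) ht)) heq
    rw [sub_zero]
    exact norm_pos_iff.mp (by rw [show ‖z‖ = 1 by simpa using hz]; exact one_pos)
  refine ⟨hcont.circleIntegrable zero_le_one, ?_⟩
  have hratio := betaRatio_eq_const hp0 hq0 hp hq hA
  rw [betaRatio, div_eq_iff (hA.betaProduct_ne_zero hp0 hq0 hp hq),
    Real.circleAverage_eq_circleIntegral one_ne_zero,
    ← circleIntegral.integral_congr zero_le_one heq, smul_eq_mul] at hratio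
  have hP := qShifted_ne_zero_of_norm_lt_one hp hp
  have hQ := qShifted_ne_zero_of_norm_lt_one hq hq
  have hπ : (Real.pi : ℂ) ≠ 0 := by exact_mod_cast Real.pi_ne_zero
  have hI := Complex.I_ne_zero
  change _ = betaProduct p q t
  generalize (∮ z in C(0, 1), ellipticBetaIntegrand t p q z) = J at hratio ⊢
  field_simp at hratio ⊢
  linear_combination hratio
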